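/- Fix any $\alpha\in[0,1]$, any integer $m\ge 1$, and any set $\mathcal{H}_0\subseteq[m]:=\{1,\dots,m\}$ (the indices of the true null hypotheses). Let $p_1,\dots,p_m\in[0,1]$ be independent random variables that are compound p-values, i.e. \[\sum_{i\in\mathcal{H}_0}\mathbb{P}(p_i\le t)\le mt\quad\text{for all }t\in[0,1].\] Let \[\widehat{k}=\max\Big\{k\in[m]:\sum_{i=1}^m \mathbf{1}\{p_i\le \tfrac{\alpha k}{m}\}\ge k\Big\}\] (with $\widehat{k}=0$ if this set is empty), and let $\widehat{S}_{\mathrm{BH}}=\{i\in[m]:p_i\le \alpha\widehat{k}/m\}$ be the set of discoveries of the Benjamini--Hochberg procedure at level $\alpha$. Then its false discovery rate satisfies \[\mathsf{FDR}:=\mathbb{E}\left[\frac{|\widehat{S}_{\mathrm{BH}}\cap\mathcal{H}_0|}{\max\{1,|\widehat{S}_{\mathrm{BH}}|\}}\right]\le 1.93\,\alpha.\] -/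

import Mathlib

open MeasureTheory ProbabilityTheory

/-- The random variables `p i` are compound p-values for the set of true nulls `H₀` under `P`:
the sum over `i ∈ H₀` of `P (p i ≤ t)` is at most `m * t`, for every `t ∈ [0, 1]`. -/
def IsCompoundPValues {Ω : Type*} [MeasurableSpace Ω] {m : ℕ} (P : Measure Ω)
    (H₀ : Finset (Fin m)) (p : Fin m → Ω → ℝ) : Prop :=
  ∀ t ∈ Set.Icc (0 : ℝ) 1, ∑ i ∈ H₀, P.real {ω | p i ω ≤ t} ≤ (m : ℝ) * t

/-- The Benjamini-Hochberg cutoff: the largest `k ∈ {1, …, m}` such that at least `k` of the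
values `x i` are at most `α * k / m`, and `0` if there is no such `k`. -/
noncomputable def bhCutoff {m : ℕ} (α : ℝ) (x : Fin m → ℝ) : ℕ :=
  ((Finset.Icc 1 m).filter fun k : ℕ =>
    k ≤ (Finset.univ.filter fun i : Fin m => x i ≤ α * (k : ℝ) / (m : ℝ)).card).sup id

/-- The set of discoveries of the Benjamini-Hochberg procedure at level `α`. -/
noncomputable def bhSet {m : ℕ} (α : ℝ) (x : Fin m → ℝ) : Finset (Fin m) :=
  Finset.univ.filter fun i : Fin m => x i ≤ α * (bhCutoff α x : ℝ) / (m : ℝ)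

/-- The false discovery proportion of a set of discoveries `S`, for the set `H₀` of true nulls. -/
noncomputable def fdp {m : ℕ} (H₀ S : Finset (Fin m)) : ℝ :=
  ((S ∩ H₀).card : ℝ) / max 1 (S.card : ℝ)

/-- The false discovery rate of the Benjamini-Hochberg procedure at level `α` run on `p`. -/
noncomputable def bhFDR {Ω : Type*} [MeasurableSpace Ω] {m : ℕ} (P : Measure Ω)
    (α : ℝ) (H₀ : Finset (Fin m)) (p : Fin m → Ω → ℝ) : ℝ :=
  ∫ ω, fdp H₀ (bhSet α fun i => p i ω) ∂P

/-!
The values `p i` enter the procedure only through their levels, the number of thresholds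
`α * k / m` below `p i`, so everything happens under a product law on a finite set, where `prodExp`
is the expectation. Let `K` be the cutoff, `V` the number of nulls below it and `F i k` the
probability that coordinate `i` lies below `k`; the hypothesis says `∑ F i k ≤ α * k` over the
nulls. The false discovery proportion is `V / K`. Cutoffs are split at `B`, with `α * B ≤ 2`.

*Small cutoffs.* By the leave-one-out argument, `E[V / K; K ≤ B]` is the sum over the nulls of
`E[F i s / s; s ≤ B]`, where `s` is the cutoff after lowering coordinate `i` to `0`. As `s` depends
on `i`, the hypothesis does not apply directly. The reference cutoff `K'`, computed with one
additional index of lowest level, does not depend on `i`, whence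
`E[∑ F i K' / K'; K ≤ B] ≤ α * P (K ≤ B)`. It equals `s` unless coordinate `i` lies below its own
leave-one-out value, and `prodExp_shifted_ge` bounds the loss by `B / 4 * (F i s / s) ^ 2`. Summed
over the nulls this loss is at most `α * B / 4 * E[1 / K; V ≥ 1, K ≤ B]`, and
`1{V ≥ 1} ≤ (V + 1{V = 1}) / 2`. On `V = 1` the coordinates of the non-nulls determine `K`
(`stepUp_compl_eq`), so that `E[1 / K; V = 1, K ≤ B] ≤ α * P (K ≤ B)` by independence
(`prodExp_single_le`). Together, `E[V / K; K ≤ B] ≤ 5 / 3 * α * P (K ≤ B)` (`prodExp_fdp_small`).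

*Large cutoffs.* It remains to bound the excess of `V / K` over `5 / 3 * α` on `K > B`. On
`K = k`, `V = d` the non-nulls again determine `k`, through a cutoff `κ_d` that is independent of
the nulls, so the probability of this event is at most `P (κ_d = k) * P (V_k = d)`, with `V_k` the
number of nulls below `k`, a sum of independent indicators of mean at most `t = α * k > 2`. Since
`∑ k, P (κ_d = k) ≤ 1`, the excess is at most `α` times the sum over `d` of the supremum over
`t > 2` of `(d / t - 5 / 3) * P (V_k = d)`, in which only `d ≥ 4` contributes. The law of `V_k` is
ultra-log-concave, and among such laws of given mean the truncated Poisson law on `{0, …, d}` has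
the largest mass at `d` (`UltraLogConcave.le_truncated`). This reduces `4 ≤ d < 40` to a numerical
verification; a Chernoff bound takes care of `d ≥ 40`. The sum is at most `79 / 300`, and
`5 / 3 + 79 / 300 = 1.93`.
-/

/-! ### Expectations under a finite product law -/

section ProductModel

variable {ι S : Type*} [Fintype ι] [DecidableEq ι] [Fintype S]

/-- The expectation of `f` under the product law on `ι → S` whose `i`-th marginal puts mass
`q i s` on `s`. -/
def prodExp (q : ι → S → ℝ) (f : (ι → S) → ℝ) : ℝ :=
  ∑ x : ι → S, (∏ i, q i (x i)) * f x

variable {q : ι → S → ℝ}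

theorem prodExp_add (f g : (ι → S) → ℝ) :
    prodExp q (fun x => f x + g x) = prodExp q f + prodExp q g := by
  simp only [prodExp, mul_add, Finset.sum_add_distrib]

theorem prodExp_sub (f g : (ι → S) → ℝ) :
    prodExp q (fun x => f x - g x) = prodExp q f - prodExp q g := by
  simp only [prodExp, mul_sub, Finset.sum_sub_distrib]

theorem prodExp_const_mul (c : ℝ) (f : (ι → S) → ℝ) :
    prodExp q (fun x => c * f x) = c * prodExp q f := by
  simp only [prodExp, Finset.mul_sum]
  exact Finset.sum_congr rfl fun x _ => by ring

theorem prodExp_sum {κ : Type*} (s : Finset κ) (f : κ → (ι → S) → ℝ) :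
    prodExp q (fun x => ∑ j ∈ s, f j x) = ∑ j ∈ s, prodExp q (f j) := by
  simp only [prodExp, Finset.mul_sum]
  exact Finset.sum_comm

theorem prodExp_mono (h0 : ∀ i s, 0 ≤ q i s) {f g : (ι → S) → ℝ} (h : ∀ x, f x ≤ g x) :
    prodExp q f ≤ prodExp q g :=
  Finset.sum_le_sum fun x _ =>
    mul_le_mul_of_nonneg_left (h x) (Finset.prod_nonneg fun i _ => h0 i _)

theorem prodExp_nonneg (h0 : ∀ i s, 0 ≤ q i s) {f : (ι → S) → ℝ} (h : ∀ x, 0 ≤ f x) :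
    0 ≤ prodExp q f :=
  Finset.sum_nonneg fun x _ => mul_nonneg (Finset.prod_nonneg fun i _ => h0 i _) (h x)

theorem prodExp_prod (g : ι → S → ℝ) :
    prodExp q (fun x => ∏ i, g i (x i)) = ∏ i, ∑ s, q i s * g i s := by
  rw [Finset.prod_univ_sum, Fintype.piFinset_univ]
  exact Finset.sum_congr rfl fun x _ => by rw [Finset.prod_mul_distrib]

theorem prodExp_const (h1 : ∀ i, ∑ s, q i s = 1) (c : ℝ) :
    prodExp q (fun _ => c) = c := by
  have h := prodExp_prod (q := q) (fun _ _ => (1 : ℝ))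
  simp only [Finset.prod_const_one, mul_one, h1] at h
  have h' := prodExp_const_mul (q := q) c (fun _ => (1 : ℝ))
  simpa [h] using h'

/-- Redrawing the `i`-th coordinate independently does not change an expectation. The map
`(x, s) ↦ (Function.update x i s, x i)` is an involution that preserves the weights. -/
theorem prodExp_resample (h1 : ∀ i, ∑ s, q i s = 1) (i : ι) (f : (ι → S) → ℝ) :
    prodExp q f = prodExp q (fun x => ∑ s, q i s * f (Function.update x i s)) := by
  have key : ∀ (x : ι → S) (s : S), (∏ j, q j (Function.update x i s j)) * q i (x i) =
      (∏ j, q j (x j)) * q i s := by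
    intro x s
    rw [← Finset.mul_prod_erase _ _ (Finset.mem_univ i),
      ← Finset.mul_prod_erase _ (fun j => q j (x j)) (Finset.mem_univ i)]
    have : ∏ j ∈ Finset.univ.erase i, q j (Function.update x i s j) =
        ∏ j ∈ Finset.univ.erase i, q j (x j) :=
      Finset.prod_congr rfl fun j hj => by
        rw [Function.update_of_ne (Finset.ne_of_mem_erase hj)]
    rw [this, Function.update_self]
    ring
  have e : prodExp q f = ∑ z : (ι → S) × S, (∏ j, q j (z.1 j)) * q i z.2 * f z.1 := by
    rw [Fintype.sum_prod_type, prodExp]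
    refine Finset.sum_congr rfl fun x _ => ?_
    dsimp only
    rw [← Finset.sum_mul, ← Finset.mul_sum, h1, mul_one]
  have e' : prodExp q (fun x => ∑ s, q i s * f (Function.update x i s)) =
      ∑ z : (ι → S) × S, (∏ j, q j (z.1 j)) * q i z.2 * f (Function.update z.1 i z.2) := by
    rw [Fintype.sum_prod_type, prodExp]
    refine Finset.sum_congr rfl fun x _ => ?_
    rw [Finset.mul_sum]
    exact Finset.sum_congr rfl fun s _ => by ring
  rw [e, e']
  have inv : Function.Involutive
      (fun z : (ι → S) × S => (Function.update z.1 i z.2, z.1 i)) := by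
    intro z
    simp
  refine Fintype.sum_equiv inv.toPerm _ _ fun z => ?_
  simp only [Function.Involutive.coe_toPerm, key, Function.update_idem, Function.update_eq_self]

/-- A function of the coordinates in `H` and a function of the remaining coordinates are
uncorrelated. Swapping the coordinates in `H` between two independent copies is an involution that
preserves the weights. -/
theorem prodExp_mul_of_blocks (H : Finset ι)
    {g h : (ι → S) → ℝ} (hg : ∀ x y : ι → S, (∀ i ∈ H, x i = y i) → g x = g y)
    (hh : ∀ x y : ι → S, (∀ i ∉ H, x i = y i) → h x = h y) (h1 : ∀ i, ∑ s, q i s = 1) :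
    prodExp q (fun x => g x * h x) = prodExp q g * prodExp q h := by
  have tot : ∑ y : ι → S, ∏ i, q i (y i) = 1 := by
    simpa [prodExp] using prodExp_const h1 1
  have e : prodExp q (fun x => g x * h x) = ∑ z : (ι → S) × (ι → S),
      (∏ i, q i (z.1 i)) * (∏ i, q i (z.2 i)) * (g z.1 * h z.1) := by
    rw [Fintype.sum_prod_type, prodExp]
    refine Finset.sum_congr rfl fun x _ => ?_
    dsimp only
    rw [← Finset.sum_mul, ← Finset.mul_sum, tot, mul_one]
  have e' : prodExp q g * prodExp q h = ∑ z : (ι → S) × (ι → S),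
      (∏ i, q i (z.1 i)) * (∏ i, q i (z.2 i)) * (g z.1 * h z.2) := by
    rw [Fintype.sum_prod_type, prodExp, prodExp, Finset.sum_mul_sum]
    exact Finset.sum_congr rfl fun x _ => Finset.sum_congr rfl fun y _ => by ring
  rw [e, e']
  have inv : Function.Involutive (fun z : (ι → S) × (ι → S) =>
      ((fun i => if i ∈ H then z.1 i else z.2 i), fun i => if i ∈ H then z.2 i else z.1 i)) := by
    intro z
    refine Prod.ext (funext fun i => ?_) (funext fun i => ?_) <;> by_cases hi : i ∈ H <;> simp [hi]
  refine Fintype.sum_equiv inv.toPerm _ _ fun z => ?_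
  simp only [Function.Involutive.coe_toPerm]
  congr 1
  · rw [← Finset.prod_mul_distrib, ← Finset.prod_mul_distrib]
    refine Finset.prod_congr rfl fun i _ => ?_
    by_cases hi : i ∈ H <;> simp [hi, mul_comm]
  · congr 1
    · exact hg _ _ fun i hi => by simp [hi]
    · exact hh _ _ fun i hi => by simp [hi]

end ProductModel

section Levels

variable {ι : Type*} {n : ℕ} {q : ι → Fin n → ℝ}

/-- The distribution function `P (x i < k)` of the `i`-th coordinate under the product law. -/
def levelCDF (q : ι → Fin n → ℝ) (i : ι) (k : ℕ) : ℝ :=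
  ∑ s : Fin n, if (s : ℕ) < k then q i s else 0

theorem levelCDF_nonneg (h0 : ∀ i s, 0 ≤ q i s) (i : ι) (k : ℕ) : 0 ≤ levelCDF q i k :=
  Finset.sum_nonneg fun s _ => by split_ifs <;> simp [h0]

theorem levelCDF_le_one (h0 : ∀ i s, 0 ≤ q i s) (h1 : ∀ i, ∑ s, q i s = 1) (i : ι) (k : ℕ) :
    levelCDF q i k ≤ 1 := by
  rw [← h1 i]
  exact Finset.sum_le_sum fun s _ => by split_ifs <;> simp [h0]

variable [Fintype ι] [DecidableEq ι]

/-- Leave-one-out identity: when the threshold `G` and the weight `Φ` ignore the value of `x i`,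
the event `x i < G` may be replaced by its conditional probability. -/
theorem prodExp_leave_one_out (h1 : ∀ i, ∑ s, q i s = 1) (i : ι) (G : (ι → Fin n) → ℕ)
    (Φ : (ι → Fin n) → ℝ) (hG : ∀ x s, G (Function.update x i s) = G x)
    (hΦ : ∀ x s, Φ (Function.update x i s) = Φ x) :
    prodExp q (fun x => if (x i : ℕ) < G x then Φ x else 0) =
      prodExp q (fun x => levelCDF q i (G x) * Φ x) := by
  rw [prodExp_resample h1 i]
  congr 1
  funext x
  simp only [hG, hΦ, Function.update_self, levelCDF, Finset.sum_mul]
  exact Finset.sum_congr rfl fun s _ => by split_ifs <;> simp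

end Levels

/-! ### Step-up cutoffs and their leave-one-out versions -/

section Cutoffs

variable {ι : Type*} {n : ℕ}

/-- The number of indices in `s` with level below `k`. -/
def countBelow (s : Finset ι) (x : ι → Fin n) (k : ℕ) : ℕ :=
  (s.filter fun i => (x i : ℕ) < k).card

/-- The largest `k ∈ {1, …, B}` such that at least `k - c` indices in `s` have level below `k`, and
`0` if there is no such `k`. For `c = 0` and `s` the set of all indices this is the step-up cutoff;
a positive `c` stands for `c` additional indices of lowest level. -/
def stepUp (s : Finset ι) (c B : ℕ) (x : ι → Fin n) : ℕ :=
  ((Finset.Icc 1 B).filter fun k => k ≤ countBelow s x k + c).sup id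

variable {s : Finset ι} {c B k : ℕ} {x y : ι → Fin n}

theorem le_stepUp (hk : 1 ≤ k) (hB : k ≤ B) (h : k ≤ countBelow s x k + c) :
    k ≤ stepUp s c B x :=
  Finset.le_sup (f := id) (by simp [hk, hB, h])

theorem stepUp_le : stepUp s c B x ≤ B :=
  Finset.sup_le fun k hk => by
    have := (Finset.mem_Icc.1 (Finset.mem_filter.1 hk).1).2
    simpa using this

theorem stepUp_le_count : stepUp s c B x ≤ countBelow s x (stepUp s c B x) + c := by
  rcases Finset.eq_empty_or_nonempty
    ((Finset.Icc 1 B).filter fun k => k ≤ countBelow s x k + c) with h | h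
  · simp [stepUp, h]
  · obtain ⟨k, hk, e⟩ := Finset.exists_mem_eq_sup _ h (id : ℕ → ℕ)
    have e' : stepUp s c B x = k := e
    rw [e']
    exact (Finset.mem_filter.1 hk).2

theorem stepUp_eq_of_forall (hk : 1 ≤ k) (hB : k ≤ B) (h : k ≤ countBelow s x k + c)
    (h' : ∀ l, k < l → l ≤ B → countBelow s x l + c < l) : stepUp s c B x = k := by
  refine le_antisymm ?_ (le_stepUp hk hB h)
  by_contra hlt
  push Not at hlt
  have := h' _ hlt stepUp_le
  exact absurd stepUp_le_count (not_le.2 this)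

theorem stepUp_congr (h : ∀ i ∈ s, x i = y i) : stepUp s c B x = stepUp s c B y := by
  have : ∀ k, countBelow s x k = countBelow s y k := fun k =>
    congrArg Finset.card (Finset.filter_congr fun i hi => by rw [h i hi])
  simp only [stepUp, this]

theorem countBelow_mono {k l : ℕ} (h : k ≤ l) : countBelow s x k ≤ countBelow s x l :=
  Finset.card_le_card (Finset.monotone_filter_right _ fun _ _ hi => lt_of_lt_of_le hi h)

variable [Fintype ι]

theorem countBelow_add_compl [DecidableEq ι] (H : Finset ι) (x : ι → Fin n) (k : ℕ) :
    countBelow H x k + countBelow Hᶜ x k = countBelow Finset.univ x k := by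
  simp only [countBelow]
  rw [← Finset.card_union_of_disjoint
    (Finset.disjoint_filter_filter disjoint_compl_right), ← Finset.filter_union,
    Finset.union_compl]

/-- The step-up cutoff equals the number of indices below it. -/
theorem countBelow_stepUp {m : ℕ} (hm : Fintype.card ι = m) (x : ι → Fin n) :
    countBelow Finset.univ x (stepUp Finset.univ 0 m x) = stepUp Finset.univ 0 m x := by
  refine le_antisymm ?_ stepUp_le_count
  by_contra hlt
  push Not at hlt
  set K := stepUp Finset.univ 0 m x with hK
  have hN : countBelow Finset.univ x K ≤ m := hm ▸ Finset.card_le_univ _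
  have := le_stepUp (s := Finset.univ) (c := 0) (B := m) (x := x) (k := K + 1) (by omega)
    (by omega) (by have := countBelow_mono (s := Finset.univ) (x := x) (Nat.le_add_right K 1); omega)
  omega

/-- On the event that the step-up cutoff is `k` with `d` indices of `H` below it, the coordinates
outside `H` determine `k`: it is their step-up cutoff after adding `d` indices of lowest level. -/
theorem stepUp_compl_eq [DecidableEq ι] {m : ℕ} (hm : Fintype.card ι = m) (H : Finset ι)
    (x : ι → Fin n) (h : 1 ≤ stepUp Finset.univ 0 m x) :
    stepUp Hᶜ (countBelow H x (stepUp Finset.univ 0 m x)) m x = stepUp Finset.univ 0 m x := by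
  have hN := countBelow_stepUp hm x
  set K := stepUp Finset.univ 0 m x with hK
  refine stepUp_eq_of_forall h stepUp_le ?_ fun l hl hlm => ?_
  · have := countBelow_add_compl H x K
    omega
  · by_contra hcon
    push Not at hcon
    have h1 := countBelow_add_compl H x l
    have h2 := countBelow_mono (s := H) (x := x) hl.le
    have := le_stepUp (s := Finset.univ) (c := 0) (B := m) (x := x) (k := l) (by omega) hlm
      (by omega)
    omega

variable [DecidableEq ι]

theorem countBelow_univ_eq (i : ι) (x : ι → Fin n) (k : ℕ) :
    countBelow Finset.univ x k =
      countBelow (Finset.univ.erase i) x k + if (x i : ℕ) < k then 1 else 0 := by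
  rw [countBelow, countBelow, ← Finset.insert_erase (Finset.mem_univ i), Finset.filter_insert,
    Finset.erase_insert (Finset.notMem_erase i _)]
  split_ifs
  · rw [Finset.card_insert_of_notMem (by simp)]
  · rfl

variable [NeZero n]

theorem countBelow_update_zero (i : ι) (x : ι → Fin n) (hk : 1 ≤ k) :
    countBelow Finset.univ (Function.update x i 0) k =
      countBelow (Finset.univ.erase i) x k + 1 := by
  rw [countBelow_univ_eq i]
  have h0 : ((Function.update x i 0 i : Fin n) : ℕ) < k := by
    rw [Function.update_self, Fin.val_zero]; omega
  rw [if_pos h0]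
  congr 1
  exact congrArg Finset.card (Finset.filter_congr fun j hj => by
    rw [Function.update_of_ne (Finset.ne_of_mem_erase hj)])

/-- Lowering a coordinate to `0` raises a step-up cutoff. -/
theorem stepUp_le_update_zero (i : ι) (x : ι → Fin n) :
    stepUp Finset.univ c B x ≤ stepUp Finset.univ c B (Function.update x i 0) := by
  rcases Nat.eq_zero_or_pos (stepUp Finset.univ c B x) with h | h
  · omega
  refine le_stepUp h stepUp_le (stepUp_le_count.trans ?_)
  rw [countBelow_update_zero i x h, countBelow_univ_eq i x]
  split_ifs <;> omega

/-- Lowering a coordinate to `0` does not change a step-up cutoff if that coordinate lies below the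
new cutoff. -/
theorem stepUp_eq_update_zero {i : ι} {x : ι → Fin n}
    (h : (x i : ℕ) < stepUp Finset.univ c B (Function.update x i 0)) :
    stepUp Finset.univ c B x = stepUp Finset.univ c B (Function.update x i 0) := by
  refine le_antisymm (stepUp_le_update_zero i x) (le_stepUp (by omega) stepUp_le ?_)
  refine stepUp_le_count.trans ?_
  rw [countBelow_update_zero i x (by omega), countBelow_univ_eq i x, if_pos h]

theorem stepUp_update_zero_pos (hB : 1 ≤ B) (i : ι) (x : ι → Fin n) :
    1 ≤ stepUp Finset.univ c B (Function.update x i 0) :=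
  le_stepUp le_rfl hB (by rw [countBelow_update_zero i x le_rfl]; omega)

/-- If coordinate `i` does not lie below the shifted leave-one-out cutoff, then the shifted cutoff
of `x` is the unshifted leave-one-out cutoff: the additional index plays the role of `i`. -/
theorem stepUp_one_eq_update_zero {m : ℕ} (hBm : B ≤ m) {i : ι} {x : ι → Fin n}
    (h : stepUp Finset.univ 1 B (Function.update x i 0) ≤ x i)
    (hs : stepUp Finset.univ 0 m (Function.update x i 0) ≤ B) (hm : 1 ≤ m) :
    stepUp Finset.univ 1 B x = stepUp Finset.univ 0 m (Function.update x i 0) := by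
  have hs1 : 1 ≤ stepUp Finset.univ 0 m (Function.update x i 0) :=
    stepUp_update_zero_pos hm i x
  refine le_antisymm ?_ ?_
  · rcases Nat.eq_zero_or_pos (stepUp Finset.univ 1 B x) with h0 | h0
    · omega
    refine le_stepUp h0 (stepUp_le.trans hBm) ?_
    have h1 := stepUp_le_count (s := Finset.univ) (c := 1) (B := B) (x := x)
    have h2 := stepUp_le_update_zero (c := 1) (B := B) i x
    rw [countBelow_univ_eq i x, if_neg (by omega)] at h1
    rw [countBelow_update_zero i x h0]
    omega
  · refine le_stepUp hs1 hs (stepUp_le_count.trans ?_)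
    rw [countBelow_update_zero i x hs1, countBelow_univ_eq i x]
    omega

end Cutoffs

/-! ### The false discovery rate on small cutoffs -/

section SmallCutoffs

variable {ι : Type*} {n : ℕ} {q : ι → Fin n → ℝ} {α : ℝ} {m B : ℕ} {H : Finset ι}

theorem sum_levelCDF_div_le (hα : 0 ≤ α)
    (hF : ∀ k ≤ m, ∑ i ∈ H, levelCDF q i k ≤ α * k) {k : ℕ} (hk : k ≤ m) :
    ∑ i ∈ H, levelCDF q i k / k ≤ α := by
  rw [← Finset.sum_div]
  exact div_le_of_le_mul₀ (Nat.cast_nonneg k) hα (hF k hk)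

theorem sum_ite_lt_eq_countBelow (x : ι → Fin n) (k : ℕ) (c : ℝ) :
    ∑ i ∈ H, (if (x i : ℕ) < k then c else 0) = countBelow H x k * c := by
  rw [countBelow, ← Finset.sum_filter, Finset.sum_const, nsmul_eq_mul]

variable [Fintype ι] [DecidableEq ι] [NeZero n]

/-- Leave-one-out form of an expectation over the event that `x i` lies below the cutoff. -/
theorem prodExp_below_cutoff (h1 : ∀ i, ∑ s, q i s = 1) (i : ι) (φ : ℕ → ℝ) :
    prodExp q (fun x => if (x i : ℕ) < stepUp Finset.univ 0 m x then
        φ (stepUp Finset.univ 0 m x) else 0) =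
      prodExp q (fun x => levelCDF q i (stepUp Finset.univ 0 m (Function.update x i 0)) *
        φ (stepUp Finset.univ 0 m (Function.update x i 0))) := by
  rw [← prodExp_leave_one_out h1 i
    (fun x => stepUp Finset.univ 0 m (Function.update x i 0))
    (fun x => φ (stepUp Finset.univ 0 m (Function.update x i 0))) (by simp) (by simp)]
  congr 1
  funext x
  by_cases h : (x i : ℕ) < stepUp Finset.univ 0 m (Function.update x i 0)
  · rw [if_pos h, stepUp_eq_update_zero h, if_pos h]
  · rw [if_neg h, if_neg fun h' => h (h'.trans_le (stepUp_le_update_zero i x))]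

/-- Comparison with the shifted cutoff. Averaging over `x i`, the ratio `F i k / k` at the shifted
cutoff is `(1 - y) f₁ + y * (y / s)`, with `f₁` the ratio at the leave-one-out cutoff,
`y = F i s` and `s ≤ B`; minimizing over `y` loses at most `B / 4 * f₁ ^ 2`. -/
theorem prodExp_shifted_ge (h0 : ∀ i s, 0 ≤ q i s) (h1 : ∀ i, ∑ s, q i s = 1)
    (hB : 1 ≤ B) (hBm : B ≤ m) (i : ι) :
    prodExp q (fun x => if stepUp Finset.univ 0 m (Function.update x i 0) ≤ B then
        levelCDF q i (stepUp Finset.univ 0 m (Function.update x i 0)) /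
          stepUp Finset.univ 0 m (Function.update x i 0) - B / 4 *
        (levelCDF q i (stepUp Finset.univ 0 m (Function.update x i 0)) /
          stepUp Finset.univ 0 m (Function.update x i 0)) ^ 2 else 0) ≤
      prodExp q (fun x => if stepUp Finset.univ 0 m x ≤ B then
        levelCDF q i (stepUp Finset.univ 1 B x) / stepUp Finset.univ 1 B x else 0) := by
  set s₁ : (ι → Fin n) → ℕ := fun x => stepUp Finset.univ 0 m (Function.update x i 0) with hs₁
  set s₂ : (ι → Fin n) → ℕ := fun x => stepUp Finset.univ 1 B (Function.update x i 0) with hs₂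
  set f : ℕ → ℝ := fun k => levelCDF q i k / k with hf
  have fnn : ∀ k, 0 ≤ f k := fun k => div_nonneg (levelCDF_nonneg h0 i k) (Nat.cast_nonneg k)
  have step : prodExp q (fun x => if s₁ x ≤ B then f (s₁ x) - B / 4 * f (s₁ x) ^ 2 else 0) ≤
      prodExp q (fun x => (if s₁ x ≤ B then f (s₁ x) else 0) + (if (x i : ℕ) < s₂ x then
        (if s₁ x ≤ B then f (s₂ x) - f (s₁ x) else 0) else 0)) := by
    rw [prodExp_add, prodExp_leave_one_out h1 i s₂
      (fun x => if s₁ x ≤ B then f (s₂ x) - f (s₁ x) else 0) (by simp [hs₂])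
      (by simp [hs₁, hs₂]), ← prodExp_add]
    refine prodExp_mono h0 fun x => ?_
    by_cases h : s₁ x ≤ B
    · simp only [if_pos h]
      have hs2 : (1 : ℝ) ≤ s₂ x := by exact_mod_cast stepUp_update_zero_pos hB i x
      have hs2' : (s₂ x : ℝ) ≤ B := by exact_mod_cast stepUp_le
      have hBp : (0 : ℝ) < B := by linarith
      have hy := levelCDF_nonneg h0 i (s₂ x)
      set y := levelCDF q i (s₂ x) with hy'
      have e : f (s₂ x) = y / s₂ x := rfl
      have h3 : y / B ≤ f (s₂ x) := by
        rw [e]; exact div_le_div_of_nonneg_left hy (by linarith) hs2'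
      have h4 : y * (y / B) - y * f (s₁ x) + B / 4 * f (s₁ x) ^ 2 =
          (y - B / 2 * f (s₁ x)) ^ 2 / B := by
        field_simp; ring
      have h5 : 0 ≤ (y - B / 2 * f (s₁ x)) ^ 2 / B := by positivity
      nlinarith [mul_le_mul_of_nonneg_left h3 hy]
    · simp [if_neg h]
  refine step.trans (prodExp_mono h0 fun x => ?_)
  by_cases h : s₁ x ≤ B
  · have hK : stepUp Finset.univ 0 m x ≤ B := (stepUp_le_update_zero i x).trans h
    simp only [if_pos h, if_pos hK]
    by_cases h' : (x i : ℕ) < s₂ x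
    · rw [if_pos h', stepUp_eq_update_zero h']
      exact le_of_eq (add_sub_cancel _ _)
    · rw [if_neg h', stepUp_one_eq_update_zero hBm (not_lt.1 h') h (hB.trans hBm), add_zero]
  · simp only [if_neg h, ite_self, add_zero]
    split_ifs
    · exact fnn _
    · exact le_rfl

/-- Summed over the nulls, the comparison with the shifted cutoff bounds the false discovery
proportion on small cutoffs, up to the probability of at least one false discovery. -/
theorem prodExp_fdp_small_le (h0 : ∀ i s, 0 ≤ q i s) (h1 : ∀ i, ∑ s, q i s = 1) (hα : 0 ≤ α)
    (hF : ∀ k ≤ m, ∑ i ∈ H, levelCDF q i k ≤ α * k) (hB : 1 ≤ B) (hBm : B ≤ m) :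
    prodExp q (fun x => if stepUp Finset.univ 0 m x ≤ B then
        (countBelow H x (stepUp Finset.univ 0 m x) : ℝ) / stepUp Finset.univ 0 m x else 0) -
      α * B / 4 * prodExp q (fun x => if stepUp Finset.univ 0 m x ≤ B ∧
        1 ≤ countBelow H x (stepUp Finset.univ 0 m x) then
          1 / (stepUp Finset.univ 0 m x : ℝ) else 0) ≤
      α * prodExp q (fun x => if stepUp Finset.univ 0 m x ≤ B then 1 else 0) := by
  have hi : ∀ i ∈ H, prodExp q (fun x => if (x i : ℕ) < stepUp Finset.univ 0 m x then
      (if stepUp Finset.univ 0 m x ≤ B then 1 / (stepUp Finset.univ 0 m x : ℝ) - B / 4 *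
        (levelCDF q i (stepUp Finset.univ 0 m x) / (stepUp Finset.univ 0 m x : ℝ) ^ 2)
        else 0) else 0) ≤ prodExp q (fun x => if stepUp Finset.univ 0 m x ≤ B then
        levelCDF q i (stepUp Finset.univ 1 B x) / stepUp Finset.univ 1 B x else 0) := by
    intro i _
    rw [prodExp_below_cutoff h1 i (fun k => if k ≤ B then 1 / (k : ℝ) - B / 4 *
      (levelCDF q i k / (k : ℝ) ^ 2) else 0)]
    refine le_trans (le_of_eq ?_) (prodExp_shifted_ge h0 h1 hB hBm i)
    congr 1
    funext x
    split_ifs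
    · ring
    · simp
  have hsum := Finset.sum_le_sum hi
  rw [← prodExp_sum, ← prodExp_sum] at hsum
  rw [← prodExp_const_mul, ← prodExp_const_mul, ← prodExp_sub]
  refine (prodExp_mono h0 fun x => ?_).trans (hsum.trans (prodExp_mono h0 fun x => ?_))
  · set K := stepUp Finset.univ 0 m x with hK
    by_cases hKB : K ≤ B
    · simp only [hKB, if_true, true_and]
      have hs := sum_levelCDF_div_le hα hF (stepUp_le (s := Finset.univ) (c := 0) (B := m) (x := x))
      rw [← hK] at hs
      have e : ∑ i ∈ H, (if (x i : ℕ) < K then 1 / (K : ℝ) - B / 4 *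
          (levelCDF q i K / (K : ℝ) ^ 2) else 0) = (countBelow H x K : ℝ) / K -
          B / 4 * (1 / K) * ∑ i ∈ H, (if (x i : ℕ) < K then levelCDF q i K / K else 0) := by
        rw [Finset.mul_sum, div_eq_mul_one_div (countBelow H x K : ℝ), ← sum_ite_lt_eq_countBelow,
          ← Finset.sum_sub_distrib]
        refine Finset.sum_congr rfl fun i _ => ?_
        split_ifs
        · ring
        · simp
      rw [e]
      have hle : ∑ i ∈ H, (if (x i : ℕ) < K then levelCDF q i K / K else 0) ≤
          if 1 ≤ countBelow H x K then α else 0 := by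
        split_ifs with hV
        · refine le_trans (Finset.sum_le_sum fun i _ => ?_) hs
          split_ifs
          · exact le_rfl
          · exact div_nonneg (levelCDF_nonneg h0 i K) (Nat.cast_nonneg K)
        · refine le_of_eq (Finset.sum_eq_zero fun i hiH => if_neg fun hlt => hV ?_)
          exact Finset.card_pos.2 ⟨i, Finset.mem_filter.2 ⟨hiH, hlt⟩⟩
      have h2 := mul_le_mul_of_nonneg_left hle (by positivity : (0 : ℝ) ≤ B / 4 * (1 / K))
      refine le_trans (le_of_eq ?_) (sub_le_sub_left h2 _)
      split_ifs <;> ring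
    · simp [hKB]
  · split_ifs
    · rw [mul_one]
      exact sum_levelCDF_div_le hα hF (stepUp_le.trans hBm)
    · simp

/-- The contribution of a single false discovery. Given exactly one null below the cutoff `k`, the
non-null coordinates determine `k`, which makes `k` independent of the null in question. -/
theorem prodExp_single_le (h0 : ∀ i s, 0 ≤ q i s) (h1 : ∀ i, ∑ s, q i s = 1) (hα : 0 ≤ α)
    (hm : Fintype.card ι = m) (hF : ∀ k ≤ m, ∑ i ∈ H, levelCDF q i k ≤ α * k) :
    prodExp q (fun x => if stepUp Finset.univ 0 m x ≤ B ∧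
        countBelow H x (stepUp Finset.univ 0 m x) = 1 then
          1 / (stepUp Finset.univ 0 m x : ℝ) else 0) ≤
      α * prodExp q (fun x => if stepUp Finset.univ 0 m x ≤ B then 1 else 0) := by
  set κ : (ι → Fin n) → ℕ := fun x => stepUp Hᶜ 1 m x with hκ
  have hκu : ∀ i ∈ H, ∀ x s, κ (Function.update x i s) = κ x := fun i hi x s =>
    stepUp_congr fun j hj => Function.update_of_ne
      (by rintro rfl; exact Finset.mem_compl.1 hj hi) _ _
  have hi : ∀ i ∈ H, prodExp q (fun x => if (x i : ℕ) < κ x then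
      (if stepUp Finset.univ 0 m (Function.update x i 0) ≤ B then 1 / (κ x : ℝ) else 0) else 0) ≤
      prodExp q (fun x => if stepUp Finset.univ 0 m x ≤ B then
        levelCDF q i (κ x) / κ x else 0) := by
    intro i hiH
    rw [prodExp_leave_one_out h1 i κ (fun x =>
      if stepUp Finset.univ 0 m (Function.update x i 0) ≤ B then 1 / (κ x : ℝ) else 0)
      (hκu i hiH) (by simp [hκu i hiH])]
    refine prodExp_mono h0 fun x => ?_
    have hnn : 0 ≤ levelCDF q i (κ x) / κ x :=
      div_nonneg (levelCDF_nonneg h0 i _) (Nat.cast_nonneg _)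
    by_cases h : stepUp Finset.univ 0 m (Function.update x i 0) ≤ B
    · rw [if_pos h, if_pos ((stepUp_le_update_zero i x).trans h), mul_one_div]
    · rw [if_neg h, mul_zero]
      split_ifs
      · exact hnn
      · exact le_rfl
  have hsum := Finset.sum_le_sum hi
  rw [← prodExp_sum, ← prodExp_sum] at hsum
  rw [← prodExp_const_mul]
  refine (prodExp_mono h0 fun x => ?_).trans (hsum.trans (prodExp_mono h0 fun x => ?_))
  · have hnn : ∀ i, 0 ≤ if (x i : ℕ) < κ x then
        (if stepUp Finset.univ 0 m (Function.update x i 0) ≤ B then 1 / (κ x : ℝ) else 0)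
        else 0 := fun i => by split_ifs <;> positivity
    split_ifs with h
    · obtain ⟨hKB, hV⟩ := h
      obtain ⟨i, hiV⟩ := Finset.card_pos.1 (by
        rw [← countBelow, hV]; exact one_pos :
        0 < (H.filter fun i => (x i : ℕ) < stepUp Finset.univ 0 m x).card)
      obtain ⟨hiH, hlt⟩ := Finset.mem_filter.1 hiV
      have hκx : κ x = stepUp Finset.univ 0 m x := by
        have := stepUp_compl_eq hm H x (by omega)
        rwa [hV] at this
      have hs := stepUp_eq_update_zero (hlt.trans_le (stepUp_le_update_zero i x))
      refine le_trans (le_of_eq ?_) (Finset.single_le_sum (fun i _ => hnn i) hiH)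
      rw [hκx, if_pos hlt, ← hs, if_pos hKB]
    · exact Finset.sum_nonneg fun i _ => hnn i
  · split_ifs
    · rw [mul_one]
      exact sum_levelCDF_div_le hα hF stepUp_le
    · simp

/-- On cutoffs at most `B ≤ 2 / α`, the false discovery proportion contributes at most `5 / 3 * α`
times the probability of such a cutoff. -/
theorem prodExp_fdp_small (h0 : ∀ i s, 0 ≤ q i s) (h1 : ∀ i, ∑ s, q i s = 1) (hα : 0 ≤ α)
    (hm : Fintype.card ι = m) (hF : ∀ k ≤ m, ∑ i ∈ H, levelCDF q i k ≤ α * k)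
    (hB : 1 ≤ B) (hBm : B ≤ m) (hαB : α * B ≤ 2) :
    prodExp q (fun x => if stepUp Finset.univ 0 m x ≤ B then
        (countBelow H x (stepUp Finset.univ 0 m x) : ℝ) / stepUp Finset.univ 0 m x else 0) ≤
      5 / 3 * α * prodExp q (fun x => if stepUp Finset.univ 0 m x ≤ B then 1 else 0) := by
  have hA := prodExp_fdp_small_le h0 h1 hα hF hB hBm
  have hx := prodExp_single_le (B := B) h0 h1 hα hm hF
  -- `1{V ≥ 1} ≤ (V + 1{V = 1}) / 2`
  have hV : prodExp q (fun x => if stepUp Finset.univ 0 m x ≤ B ∧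
        1 ≤ countBelow H x (stepUp Finset.univ 0 m x) then
          1 / (stepUp Finset.univ 0 m x : ℝ) else 0) ≤
      1 / 2 * prodExp q (fun x => if stepUp Finset.univ 0 m x ≤ B then
        (countBelow H x (stepUp Finset.univ 0 m x) : ℝ) / stepUp Finset.univ 0 m x else 0) +
      1 / 2 * prodExp q (fun x => if stepUp Finset.univ 0 m x ≤ B ∧
        countBelow H x (stepUp Finset.univ 0 m x) = 1 then
          1 / (stepUp Finset.univ 0 m x : ℝ) else 0) := by
    rw [← prodExp_const_mul, ← prodExp_const_mul, ← prodExp_add]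
    refine prodExp_mono h0 fun x => ?_
    set K := stepUp Finset.univ 0 m x
    set V := countBelow H x K
    by_cases hKB : K ≤ B
    · simp only [hKB, if_true, true_and]
      have hK : (0 : ℝ) ≤ 1 / K := by positivity
      rw [div_eq_mul_one_div (V : ℝ)]
      rcases Nat.lt_trichotomy V 1 with hlt | heq | hgt
      · have : V = 0 := by omega
        simp [this]
      · simp only [heq, le_refl, if_true, Nat.cast_one]
        linarith
      · have h2 : (2 : ℝ) ≤ V := by exact_mod_cast hgt
        rw [if_pos hgt.le, if_neg hgt.ne']
        nlinarith
    · simp [hKB]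
  have hAnn : 0 ≤ prodExp q (fun x => if stepUp Finset.univ 0 m x ≤ B then
      (countBelow H x (stepUp Finset.univ 0 m x) : ℝ) / stepUp Finset.univ 0 m x else 0) :=
    prodExp_nonneg h0 fun x => by split_ifs <;> positivity
  have hWnn : 0 ≤ prodExp q (fun x => if stepUp Finset.univ 0 m x ≤ B ∧
        1 ≤ countBelow H x (stepUp Finset.univ 0 m x) then
          1 / (stepUp Finset.univ 0 m x : ℝ) else 0) :=
    prodExp_nonneg h0 fun x => by split_ifs <;> positivity
  have h2 := mul_le_mul_of_nonneg_right hαB hWnn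
  linarith

end SmallCutoffs

/-! ### Ultra-log-concavity and the point probabilities of sums of indicators -/

section UltraLogConcave

/-- Ultra-log-concavity of a sequence `p`, in the form that the ratios
`(j + 1) * p (j + 1) / p j` decrease in `j`, with cleared denominators. This form also rules out
internal zeros. -/
def UltraLogConcave (p : ℕ → ℝ) : Prop :=
  ∀ i j : ℕ, i ≤ j → ((j : ℝ) + 1) * p (j + 1) * p i ≤ ((i : ℝ) + 1) * p (i + 1) * p j

/-- Adding an independent indicator of probability `F` preserves ultra-log-concavity. -/
theorem UltraLogConcave.add_indicator {p p' : ℕ → ℝ} (hp : UltraLogConcave p)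
    (hnn : ∀ j, 0 ≤ p j) {F : ℝ} (hF0 : 0 ≤ F) (hF1 : F ≤ 1) (h0 : p' 0 = (1 - F) * p 0)
    (hs : ∀ j, p' (j + 1) = (1 - F) * p (j + 1) + F * p j) : UltraLogConcave p' := by
  intro i j hij
  have ha : 0 ≤ 1 - F := by linarith
  rcases hij.eq_or_lt with rfl | hij
  · exact le_rfl
  obtain ⟨j, rfl⟩ : ∃ l, j = l + 1 := ⟨j - 1, by omega⟩
  have hA := hp i (j + 1) hij.le
  have hD := hp i j (by omega)
  have hij' : (i : ℝ) ≤ j := by exact_mod_cast Nat.lt_succ_iff.1 hij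
  cases i with
  | zero =>
    rw [hs, hs, hs, h0]
    push_cast at hA hD ⊢
    have e : (0 + 1 : ℝ) * ((1 - F) * p (0 + 1) + F * p 0) * ((1 - F) * p (j + 1) + F * p j) -
        ((j : ℝ) + 1 + 1) * ((1 - F) * p (j + 1 + 1) + F * p (j + 1)) * ((1 - F) * p 0) =
        (1 - F) ^ 2 * ((0 + 1) * p (0 + 1) * p (j + 1) - (j + 1 + 1) * p (j + 1 + 1) * p 0) +
        (1 - F) * F * ((0 + 1) * p (0 + 1) * p j - (j + 1) * p (j + 1) * p 0) +
        F ^ 2 * (p 0 * p j) := by ring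
    have h1 := mul_nonneg (sq_nonneg (1 - F)) (sub_nonneg.2 hA)
    have h2 := mul_nonneg (mul_nonneg ha hF0) (sub_nonneg.2 hD)
    have h3 := mul_nonneg (sq_nonneg F) (mul_nonneg (hnn 0) (hnn j))
    linarith
  | succ i =>
    have hB := hp i j (by omega)
    have hC := hp i (j + 1) (by omega)
    rw [hs, hs, hs, hs]
    push_cast at hA hB hC hD hij' ⊢
    have e : ((i : ℝ) + 1 + 1) * ((1 - F) * p (i + 1 + 1) + F * p (i + 1)) *
          ((1 - F) * p (j + 1) + F * p j) -
        ((j : ℝ) + 1 + 1) * ((1 - F) * p (j + 1 + 1) + F * p (j + 1)) *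
          ((1 - F) * p (i + 1) + F * p i) =
        (1 - F) ^ 2 * ((i + 1 + 1) * p (i + 1 + 1) * p (j + 1) -
          (j + 1 + 1) * p (j + 1 + 1) * p (i + 1)) +
        (1 - F) * F * (((i + 1 + 1) * p (i + 1 + 1) * p j - (j + 1) * p (j + 1) * p (i + 1)) +
          ((i + 1) * p (i + 1) * p (j + 1) - (j + 1 + 1) * p (j + 1 + 1) * p i)) +
        F ^ 2 * ((i + 1 + 1) * p (i + 1) * p j - (j + 1 + 1) * p (j + 1) * p i) := by ring
    -- the `F ^ 2` term: `(j + 2) / (j + 1) ≤ (i + 2) / (i + 1)`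
    have hB' : ((j : ℝ) + 1 + 1) * p (j + 1) * p i ≤ ((i : ℝ) + 1 + 1) * p (i + 1) * p j := by
      have hj : (0 : ℝ) < j + 1 := by positivity
      have h1 := mul_le_mul_of_nonneg_left hB (by positivity : (0 : ℝ) ≤ j + 1 + 1)
      have h2 : ((j : ℝ) + 1 + 1) * ((i + 1) * p (i + 1) * p j) ≤
          (j + 1) * ((i + 1 + 1) * p (i + 1) * p j) := by
        nlinarith [mul_nonneg (mul_nonneg (sub_nonneg.2 hij') (hnn (i + 1))) (hnn j),
          mul_nonneg (hnn (i + 1)) (hnn j)]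
      refine le_of_mul_le_mul_left ?_ hj
      linarith
    have h1 := mul_nonneg (sq_nonneg (1 - F)) (sub_nonneg.2 hA)
    have h2 := mul_nonneg (mul_nonneg ha hF0) (add_nonneg (sub_nonneg.2 hD) (sub_nonneg.2 hC))
    have h3 := mul_nonneg (sq_nonneg F) (sub_nonneg.2 hB')
    linarith

/-- The truncated Poisson law maximizes the mass at `d` among ultra-log-concave laws of a given
mean. Here `t j / ∑ j ≤ d, t j` is the truncated Poisson law of parameter `r` on `{0, …, d}`, with
mean `r * (1 - t d / ∑ j ≤ d, t j)`, and `hmean` says that `p` has mean at most `μ`. If `p d` were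
larger, `p` would exceed the truncated law on an interval `[l, d]` and stay below it on `[0, l)`,
so `p` would have the larger mean. -/
theorem UltraLogConcave.le_truncated {p t : ℕ → ℝ} (hp : UltraLogConcave p) (hnn : ∀ j, 0 ≤ p j)
    {r μ : ℝ} (hr : 0 < r) (ht : ∀ j, 0 < t j) (hrec : ∀ j : ℕ, ((j : ℝ) + 1) * t (j + 1) = r * t j)
    {d : ℕ} (hmean : ∀ c : ℝ, c ≤ d → ∑ j ∈ Finset.range (d + 1), ((j : ℝ) - c) * p j ≤ μ - c)
    (hμ : μ * ∑ j ∈ Finset.range (d + 1), t j ≤ r * ∑ j ∈ Finset.range d, t j) :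
    p d * ∑ j ∈ Finset.range (d + 1), t j ≤ t d := by
  set S := ∑ j ∈ Finset.range (d + 1), t j with hS
  have hSpos : 0 < S := Finset.sum_pos (fun j _ => ht j) (by simp)
  by_contra hlt
  push Not at hlt
  classical
  have hex : ∃ l, l ≤ d ∧ ∀ j, l ≤ j → j ≤ d → t j ≤ p j * S :=
    ⟨d, le_rfl, fun j h1 h2 => by rw [le_antisymm h2 h1]; exact hlt.le⟩
  set l := Nat.find hex with hl
  obtain ⟨hld, hge⟩ := Nat.find_spec hex
  rw [← hl] at hld hge
  have hle : ∀ j, j < l → p j * S ≤ t j := by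
    rcases Nat.eq_zero_or_pos l with h0 | h0
    · intro j hj; omega
    obtain ⟨k, hk⟩ : ∃ k, l = k + 1 := ⟨l - 1, by omega⟩
    have hk1 : p k * S < t k := by
      have hmin := Nat.find_min hex (m := k) (by omega)
      by_contra hcon
      push Not at hcon
      refine hmin ⟨by omega, fun j h1 h2 => ?_⟩
      rcases h1.eq_or_lt with rfl | h1
      · exact hcon
      · exact hge j (by omega) h2
    have hk2 : t (k + 1) ≤ p (k + 1) * S := hge (k + 1) (by omega) (by omega)
    have hk3 : r * p k < ((k : ℝ) + 1) * p (k + 1) := by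
      have h1 := mul_lt_mul_of_pos_left hk1 hr
      have h2 := mul_le_mul_of_nonneg_left hk2 (by positivity : (0 : ℝ) ≤ (k : ℝ) + 1)
      rw [hrec] at h2
      refine lt_of_mul_lt_mul_right ?_ hSpos.le
      linarith
    -- below `l` the sequence `p` grows at least as fast as `t`
    have hgrow : ∀ j, j ≤ k → r * p j ≤ ((j : ℝ) + 1) * p (j + 1) := by
      intro j hj
      have hu := hp j k hj
      rcases (hnn k).eq_or_lt with h0 | h0
      · rw [← h0, mul_zero] at hu
        have hpos : 0 < ((k : ℝ) + 1) * p (k + 1) := by rw [← h0, mul_zero] at hk3; exact hk3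
        have hz : p j = 0 := le_antisymm (by
          by_contra hc
          push Not at hc
          exact absurd hu (not_le.2 (mul_pos hpos hc))) (hnn j)
        rw [hz, mul_zero]
        have := hnn (j + 1)
        positivity
      · have h1 := mul_le_mul_of_nonneg_right hk3.le (hnn j)
        refine le_of_mul_le_mul_right ?_ h0
        linarith
    have hdesc : ∀ i, i ≤ k → p (k - i) * S ≤ t (k - i) := by
      intro i
      induction i with
      | zero => intro _; exact hk1.le
      | succ i ih =>
        intro hi
        have h1 := ih (by omega)
        obtain ⟨j, hj⟩ : ∃ j, k - (i + 1) = j := ⟨_, rfl⟩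
        have hj' : k - i = j + 1 := by omega
        rw [hj]
        rw [hj'] at h1
        have h2 := mul_le_mul_of_nonneg_left h1 (by positivity : (0 : ℝ) ≤ (j : ℝ) + 1)
        rw [hrec] at h2
        have h3 := mul_le_mul_of_nonneg_right (hgrow j (by omega)) hSpos.le
        refine le_of_mul_le_mul_left ?_ hr
        linarith
    intro j hj
    have := hdesc (k - j) (by omega)
    rwa [show k - (k - j) = j by omega] at this
  -- `c` separates the indices below `l` from the others
  set c : ℝ := (l : ℝ) - 1 / 2 with hc
  have hcd : c < d := by
    have : (l : ℝ) ≤ d := by exact_mod_cast hld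
    linarith
  have hstrict : 0 < ∑ j ∈ Finset.range (d + 1), ((j : ℝ) - c) * (p j * S - t j) := by
    refine Finset.sum_pos' (fun j hj => ?_)
      ⟨d, by simp, mul_pos (by linarith) (by linarith)⟩
    have hj' : j ≤ d := Nat.lt_succ_iff.1 (Finset.mem_range.1 hj)
    rcases lt_or_ge j l with h | h
    · have h1 : (j : ℝ) + 1 ≤ l := by exact_mod_cast h
      exact mul_nonneg_of_nonpos_of_nonpos (by linarith) (by linarith [hle j h])
    · have h1 : (l : ℝ) ≤ j := by exact_mod_cast h
      exact mul_nonneg (by linarith) (by linarith [hge j h hj'])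
  have hfirst : ∑ j ∈ Finset.range (d + 1), (j : ℝ) * t j = r * ∑ j ∈ Finset.range d, t j := by
    rw [Finset.sum_range_succ', Finset.mul_sum]
    simp only [Nat.cast_zero, zero_mul, add_zero]
    exact Finset.sum_congr rfl fun j _ => by rw [← hrec]; push_cast; ring
  have e : ∑ j ∈ Finset.range (d + 1), ((j : ℝ) - c) * (p j * S - t j) =
      (∑ j ∈ Finset.range (d + 1), ((j : ℝ) - c) * p j) * S -
        (∑ j ∈ Finset.range (d + 1), (j : ℝ) * t j - c * S) := by
    have hcS : c * S = ∑ j ∈ Finset.range (d + 1), c * t j := Finset.mul_sum _ _ _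
    rw [hcS, Finset.sum_mul, ← Finset.sum_sub_distrib, ← Finset.sum_sub_distrib]
    exact Finset.sum_congr rfl fun j _ => by ring
  rw [e, hfirst] at hstrict
  have := mul_le_mul_of_nonneg_right (hmean c hcd.le) hSpos.le
  linarith

end UltraLogConcave

section PoissonBinomial

variable {ι : Type*} {n : ℕ} {q : ι → Fin n → ℝ} {H : Finset ι} {k : ℕ}

theorem sum_mul_ite_lt (h1 : ∀ i, ∑ s, q i s = 1) (i : ι) (a b : ℝ) :
    ∑ s, q i s * (if (s : ℕ) < k then a else b) =
      (1 - levelCDF q i k) * b + levelCDF q i k * a := by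
  have : ∀ s : Fin n, q i s * (if (s : ℕ) < k then a else b) =
      q i s * b + (if (s : ℕ) < k then q i s else 0) * (a - b) := fun s => by
    split_ifs <;> ring
  simp only [this, Finset.sum_add_distrib, ← Finset.sum_mul, h1, levelCDF]
  ring

theorem countBelow_insert_update [DecidableEq ι] {i : ι} (hi : i ∉ H) (x : ι → Fin n) (s : Fin n) :
    countBelow (insert i H) (Function.update x i s) k =
      if (s : ℕ) < k then countBelow H x k + 1 else countBelow H x k := by
  have e : (H.filter fun j => (Function.update x i s j : ℕ) < k) =
      H.filter fun j => (x j : ℕ) < k := Finset.filter_congr fun j hj => by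
    rw [Function.update_of_ne (by rintro rfl; exact hi hj)]
  rw [countBelow, Finset.filter_insert, Function.update_self, e]
  split_ifs
  · rw [Finset.card_insert_of_notMem (by simp [hi])]; rfl
  · rfl

variable [Fintype ι] [DecidableEq ι]

/-- The law of the number of indices in `H` with level below `k` (a Poisson-binomial law). -/
def countLaw (q : ι → Fin n → ℝ) (H : Finset ι) (k d : ℕ) : ℝ :=
  prodExp q (fun x => if countBelow H x k = d then 1 else 0)

theorem countLaw_nonneg (h0 : ∀ i s, 0 ≤ q i s) (d : ℕ) : 0 ≤ countLaw q H k d :=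
  prodExp_nonneg h0 fun x => by split_ifs <;> norm_num

theorem prodExp_ite_lt (h1 : ∀ i, ∑ s, q i s = 1) (i : ι) :
    prodExp q (fun x => if (x i : ℕ) < k then 1 else 0) = levelCDF q i k := by
  rw [prodExp_resample h1 i]
  simp only [Function.update_self, sum_mul_ite_lt h1, mul_zero, mul_one, zero_add]
  exact prodExp_const h1 _

theorem countLaw_insert (h1 : ∀ i, ∑ s, q i s = 1) {i : ι} (hi : i ∉ H) (d : ℕ) :
    countLaw q (insert i H) k d = (1 - levelCDF q i k) * countLaw q H k d +
      levelCDF q i k * prodExp q (fun x => if countBelow H x k + 1 = d then 1 else 0) := by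
  rw [countLaw, prodExp_resample h1 i, countLaw, ← prodExp_const_mul, ← prodExp_const_mul,
    ← prodExp_add]
  congr 1
  funext x
  rw [← sum_mul_ite_lt h1]
  refine Finset.sum_congr rfl fun s _ => ?_
  rw [countBelow_insert_update hi]
  split_ifs <;> simp_all

theorem countLaw_ultraLogConcave (h0 : ∀ i s, 0 ≤ q i s) (h1 : ∀ i, ∑ s, q i s = 1)
    (H : Finset ι) (k : ℕ) : UltraLogConcave (countLaw q H k) := by
  induction H using Finset.induction_on with
  | empty =>
    have e : ∀ d, countLaw q (∅ : Finset ι) k d = if d = 0 then 1 else 0 := fun d => by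
      rw [← prodExp_const (q := q) h1 (if d = 0 then (1 : ℝ) else 0), countLaw]
      congr 1
      funext x
      simp only [countBelow, Finset.filter_empty, Finset.card_empty, eq_comm]
    intro i j _
    rw [e, e, e, e]
    simp
  | insert i H hi ih =>
    refine ih.add_indicator (countLaw_nonneg h0) (levelCDF_nonneg h0 i k)
      (levelCDF_le_one h0 h1 i k) ?_ fun j => ?_
    · rw [countLaw_insert h1 hi]
      simp only [Nat.add_eq_zero_iff, one_ne_zero, and_false, if_false, prodExp_const h1, mul_zero,
        add_zero]
    · rw [countLaw_insert h1 hi]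
      simp only [Nat.add_right_cancel_iff]
      rfl

theorem prodExp_countBelow (h1 : ∀ i, ∑ s, q i s = 1) (H : Finset ι) (k : ℕ) :
    prodExp q (fun x => (countBelow H x k : ℝ)) = ∑ i ∈ H, levelCDF q i k := by
  simp only [countBelow, Finset.card_filter, Nat.cast_sum, Nat.cast_ite, Nat.cast_one,
    Nat.cast_zero]
  rw [prodExp_sum]
  exact Finset.sum_congr rfl fun i _ => prodExp_ite_lt h1 i

/-- The first moment of the law up to `d`, centred at `c ≤ d`, is at most the full centred first
moment: the omitted terms are nonnegative. -/
theorem sum_sub_mul_countLaw_le (h0 : ∀ i s, 0 ≤ q i s) (h1 : ∀ i, ∑ s, q i s = 1) {d : ℕ} {c : ℝ}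
    (hc : c ≤ d) : ∑ j ∈ Finset.range (d + 1), ((j : ℝ) - c) * countLaw q H k j ≤
      ∑ i ∈ H, levelCDF q i k - c := by
  rw [← prodExp_countBelow h1, ← prodExp_const (q := q) h1 c, ← prodExp_sub]
  simp only [countLaw, prodExp_const h1, ← prodExp_const_mul]
  rw [← prodExp_sum]
  refine prodExp_mono h0 fun x => ?_
  simp only [mul_ite, mul_one, mul_zero]
  rw [Finset.sum_ite_eq]
  split_ifs with h
  · exact le_rfl
  · have h1 : d + 1 ≤ countBelow H x k := by simpa using h
    have h2 : ((d : ℝ) + 1) ≤ countBelow H x k := by exact_mod_cast h1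
    linarith

/-- Chernoff bound for a point probability. -/
theorem countLaw_mul_pow_le (h0 : ∀ i s, 0 ≤ q i s) (h1 : ∀ i, ∑ s, q i s = 1) {r t : ℝ}
    (hr : 1 ≤ r) (ht : ∑ i ∈ H, levelCDF q i k ≤ t) (d : ℕ) :
    countLaw q H k d * r ^ d ≤ Real.exp (t * (r - 1)) := by
  have hgen : prodExp q (fun x => r ^ countBelow H x k) =
      ∏ i ∈ H, (1 + levelCDF q i k * (r - 1)) := by
    have e : ∀ x : ι → Fin n, r ^ countBelow H x k =
        ∏ i, if i ∈ H then (if (x i : ℕ) < k then r else 1) else 1 := fun x => by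
      rw [Finset.prod_ite_mem, Finset.univ_inter, Finset.prod_ite, Finset.prod_const,
        Finset.prod_const_one, mul_one]
      rfl
    simp only [e]
    rw [prodExp_prod (fun i (s : Fin n) => if i ∈ H then (if (s : ℕ) < k then r else 1) else 1),
      ← Finset.prod_subset (Finset.subset_univ H)]
    · refine Finset.prod_congr rfl fun i hi => ?_
      simp only [if_pos hi, sum_mul_ite_lt h1]
      ring
    · intro i _ hi
      simp [hi, h1]
  have h2 : countLaw q H k d * r ^ d ≤ prodExp q (fun x => r ^ countBelow H x k) := by
    rw [countLaw, mul_comm, ← prodExp_const_mul]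
    refine prodExp_mono h0 fun x => ?_
    split_ifs with h
    · rw [h, mul_one]
    · rw [mul_zero]; positivity
  refine h2.trans (hgen.le.trans ?_)
  calc ∏ i ∈ H, (1 + levelCDF q i k * (r - 1))
      ≤ ∏ i ∈ H, Real.exp (levelCDF q i k * (r - 1)) :=
        Finset.prod_le_prod
          (fun i _ => by
            have := mul_nonneg (levelCDF_nonneg h0 i k) (sub_nonneg.2 hr); linarith)
          fun i _ => by linarith [Real.add_one_le_exp (levelCDF q i k * (r - 1))]
    _ = Real.exp ((∑ i ∈ H, levelCDF q i k) * (r - 1)) := by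
        rw [← Real.exp_sum, Finset.sum_mul]
    _ ≤ Real.exp (t * (r - 1)) :=
        Real.exp_le_exp.2 (mul_le_mul_of_nonneg_right ht (sub_nonneg.2 hr))

end PoissonBinomial

/-! ### Numerical bounds for the excess of a single point probability -/

section Numerics

/-- The partial sum `∑ i ≤ j, (a / 10) ^ i / i !` of the exponential series, multiplied by
`10 ^ j * j !` to make it a natural number. -/
def scaledExpSum (a : ℕ) : ℕ → ℕ
  | 0 => 1
  | j + 1 => scaledExpSum a j * (10 * (j + 1)) + a ^ (j + 1)

/-- The bound for the excess of the point probability at `d`. Below `40` it dominates a numerical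
maximum over the time `t`; from `40` on it comes from a Chernoff bound. -/
noncomputable def excessBound (d : ℕ) : ℝ :=
  if d < 40 then 21 / (2 * ((d : ℝ) + 1) ^ 3) else (9 / 10) ^ d / 24

theorem excessBound_nonneg (d : ℕ) : 0 ≤ excessBound d := by
  unfold excessBound
  split_ifs <;> positivity

/-- The total excess; `5 / 3 + 79 / 300 = 1.93`. -/
theorem sum_excessBound_le (m : ℕ) : ∑ d ∈ Finset.Icc 4 m, excessBound d ≤ 79 / 300 := by
  have h40 : ∑ d ∈ Finset.Ico 4 40, excessBound d ≤ 51 / 200 := by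
    have e : ∀ d ∈ Finset.Ico 4 40, excessBound d = 21 / (2 * ((d : ℝ) + 1) ^ 3) := fun d hd =>
      if_pos (Finset.mem_Ico.1 hd).2
    rw [Finset.sum_congr rfl e]
    norm_num [Finset.sum_Ico_succ_top]
  have hgeom : ∀ N : ℕ, ∑ d ∈ Finset.Ico 4 (40 + N), excessBound d ≤
      51 / 200 + 10 / 24 * ((9 / 10) ^ 40 - (9 / 10) ^ (40 + N)) := by
    intro N
    induction N with
    | zero => simpa using h40
    | succ N ih =>
      rw [← add_assoc, Finset.sum_Ico_succ_top (by omega), excessBound, if_neg (by omega),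
        pow_succ _ (40 + N)]
      linarith
  have hpow : (0 : ℝ) ≤ (9 / 10) ^ (40 + m) := by positivity
  have hp40 : ((9 : ℝ) / 10) ^ 40 ≤ 1 / 50 := by norm_num
  calc ∑ d ∈ Finset.Icc 4 m, excessBound d ≤ ∑ d ∈ Finset.Ico 4 (40 + m), excessBound d :=
        Finset.sum_le_sum_of_subset_of_nonneg
          (fun d hd => by simp only [Finset.mem_Icc, Finset.mem_Ico] at hd ⊢; omega)
          fun d _ _ => excessBound_nonneg d
    _ ≤ 51 / 200 + 10 / 24 * ((9 / 10) ^ 40 - (9 / 10) ^ (40 + m)) := hgeom m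
    _ ≤ 79 / 300 := by linarith

/-- With `τ = max 2 M`, where `M` is the mean of the Poisson law of parameter `a / 10` truncated to
`{0, …, d}`, this is the inequality
`(d / τ - 5 / 3) * b ≤ 21 / (2 * (d + 1) ^ 3)` in natural numbers, where `b` is the mass at `d` of
the Poisson law of parameter `(a + 1) / 10` truncated to `{0, …, d}`. -/
def CellBound (d a : ℕ) : Prop :=
  (3 * d - 10) * (a + 1) ^ d * (d + 1) ^ 3 ≤ 63 * scaledExpSum (a + 1) d ∨
    2 * (3 * scaledExpSum a d - 5 * a * scaledExpSum a (d - 1)) * (a + 1) ^ d * (d + 1) ^ 3 ≤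
      63 * (a * scaledExpSum a (d - 1)) * scaledExpSum (a + 1) d

instance (d a : ℕ) : Decidable (CellBound d a) := by unfold CellBound; infer_instance

theorem cellBound_of_lt_forty :
    ∀ d < 40, 4 ≤ d → ∀ l < 8 * d - 20, CellBound d (20 + l) := by
  decide +kernel

/-- The Poisson law of parameter `4 / 5 * d` truncated to `{0, …, d}` has mean at least `3 / 5 * d`,
the time from which on the excess at `d` is nonpositive. -/
theorem scaledExpSum_eight_mul : ∀ d < 40, 4 ≤ d →
    3 * scaledExpSum (8 * d) d ≤ 5 * (8 * d) * scaledExpSum (8 * d) (d - 1) := by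
  decide +kernel

theorem scaledExpSum_pos (a j : ℕ) : 0 < scaledExpSum a j := by
  induction j with
  | zero => exact one_pos
  | succ j ih =>
    rw [scaledExpSum]
    positivity

theorem sum_range_exp_eq (a j : ℕ) :
    ∑ i ∈ Finset.range (j + 1), ((a : ℝ) / 10) ^ i / i.factorial =
      scaledExpSum a j / (10 ^ j * j.factorial) := by
  induction j with
  | zero => simp [scaledExpSum]
  | succ j ih =>
    rw [Finset.sum_range_succ, ih, scaledExpSum, Nat.factorial_succ]
    have : (j.factorial : ℝ) ≠ 0 := by positivity
    push_cast
    rw [div_pow]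
    field_simp
    ring

/-- The bound by the truncated Poisson law of parameter `a / 10`, with denominators cleared. -/
theorem UltraLogConcave.mul_scaledExpSum_le {p : ℕ → ℝ} (hp : UltraLogConcave p)
    (hnn : ∀ j, 0 ≤ p j) {a d : ℕ} (ha : 0 < a) (hd : 0 < d) {μ : ℝ}
    (hmean : ∀ c : ℝ, c ≤ d → ∑ j ∈ Finset.range (d + 1), ((j : ℝ) - c) * p j ≤ μ - c)
    (hμ : μ * scaledExpSum a d ≤ a * d * scaledExpSum a (d - 1)) :
    p d * scaledExpSum a d ≤ a ^ d := by
  obtain ⟨e, rfl⟩ : ∃ e, d = e + 1 := ⟨d - 1, by omega⟩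
  have haR : (0 : ℝ) < a := by exact_mod_cast ha
  have hf : (0 : ℝ) < (e.factorial : ℝ) := by positivity
  have h := hp.le_truncated hnn (r := (a : ℝ) / 10) (μ := μ)
    (t := fun i => ((a : ℝ) / 10) ^ i / i.factorial) (by positivity) (fun j => by positivity)
    (fun j => by
      rw [Nat.factorial_succ, pow_succ]; push_cast
      have : (j.factorial : ℝ) ≠ 0 := by positivity
      field_simp) hmean (by
      rw [sum_range_exp_eq, sum_range_exp_eq, Nat.factorial_succ]
      rw [Nat.add_sub_cancel] at hμ
      push_cast at hμ ⊢
      rw [← mul_div_assoc, div_mul_div_comm, div_le_div_iff₀ (by positivity) (by positivity)]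
      have := mul_le_mul_of_nonneg_right hμ (by positivity : (0 : ℝ) ≤ 10 * (10 ^ e * e.factorial))
      refine this.trans (le_of_eq ?_)
      ring)
  rw [sum_range_exp_eq, div_pow, ← mul_div_assoc, div_div] at h
  exact (div_le_div_iff_of_pos_right (by positivity)).1 h

/-- The excess of the point probability at `4 ≤ d < 40`. The time `t` lies between the means of two
truncated Poisson laws with consecutive parameters in `ℕ / 10`, and the larger one bounds `p d`. -/
theorem excess_le_of_lt_forty {p : ℕ → ℝ} (hp : UltraLogConcave p)
    (hnn : ∀ j, 0 ≤ p j) {d : ℕ} (hd4 : 4 ≤ d) (hd40 : d < 40) {t : ℝ} (ht : 2 < t)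
    (hmean : ∀ c : ℝ, c ≤ d → ∑ j ∈ Finset.range (d + 1), ((j : ℝ) - c) * p j ≤ t - c) :
    (d / t - 5 / 3) * p d ≤ excessBound d := by
  have htpos : 0 < t := by linarith
  have hdpos : (0 : ℝ) < d := by exact_mod_cast (by omega : 0 < d)
  rcases le_or_gt ((d : ℝ) / t - 5 / 3) 0 with hneg | hpos
  · exact (mul_nonpos_of_nonpos_of_nonneg hneg (hnn d)).trans (excessBound_nonneg d)
  have ht3 : 5 * t < 3 * d := by
    have h : 5 / 3 < (d : ℝ) / t := by linarith
    rw [lt_div_iff₀ htpos] at h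
    linarith
  have hend : t * scaledExpSum (20 + (8 * d - 20)) d ≤
      ((20 + (8 * d - 20) : ℕ) : ℝ) * d * scaledExpSum (20 + (8 * d - 20)) (d - 1) := by
    rw [show 20 + (8 * d - 20) = 8 * d by omega]
    have h1 : (3 * scaledExpSum (8 * d) d : ℝ) ≤
        5 * ((8 * d : ℕ) : ℝ) * scaledExpSum (8 * d) (d - 1) := by
      exact_mod_cast scaledExpSum_eight_mul d hd40 hd4
    have h2 : (0 : ℝ) ≤ scaledExpSum (8 * d) d := Nat.cast_nonneg _
    nlinarith
  have hex : ∃ l : ℕ, t * scaledExpSum (20 + l) d ≤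
      ((20 + l : ℕ) : ℝ) * d * scaledExpSum (20 + l) (d - 1) := ⟨_, hend⟩
  classical
  have hspec := Nat.find_spec hex
  have hlast : Nat.find hex ≤ 8 * d - 20 := Nat.find_min' hex hend
  rcases Nat.eq_zero_or_pos (Nat.find hex) with h0 | h0
  · -- the truncated mean for parameter `2` is less than `2`
    rw [h0, add_zero] at hspec
    have e : scaledExpSum 20 d = scaledExpSum 20 (d - 1) * (10 * d) + 20 ^ d := by
      obtain ⟨e, rfl⟩ : ∃ e, d = e + 1 := ⟨d - 1, by omega⟩
      rfl
    have e' : (scaledExpSum 20 d : ℝ) = scaledExpSum 20 (d - 1) * (10 * d) + 20 ^ d := by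
      exact_mod_cast e
    have h1 : (0 : ℝ) < scaledExpSum 20 d := by exact_mod_cast scaledExpSum_pos 20 d
    have h2 : (0 : ℝ) < 20 ^ d := by positivity
    push_cast at hspec
    nlinarith
  · obtain ⟨l, hl⟩ : ∃ l, Nat.find hex = l + 1 := ⟨Nat.find hex - 1, by omega⟩
    have hmin := Nat.find_min hex (m := l) (by omega)
    rw [hl, ← add_assoc] at hspec
    have hcell := cellBound_of_lt_forty d hd40 hd4 l (by omega)
    obtain ⟨a, ha⟩ : ∃ a, a = 20 + l := ⟨_, rfl⟩
    rw [← ha] at hspec hmin hcell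
    have hpd := hp.mul_scaledExpSum_le hnn (a := a + 1) (by omega) (by omega) hmean hspec
    push Not at hmin
    have hW : (0 : ℝ) < scaledExpSum (a + 1) d := by exact_mod_cast scaledExpSum_pos (a + 1) d
    have hU : (0 : ℝ) < ((a + 1 : ℕ) : ℝ) ^ d := by positivity
    rw [excessBound, if_pos hd40, le_div_iff₀ (by positivity)]
    have hX : (d / t - 5 / 3) * p d * scaledExpSum (a + 1) d ≤
        (d / t - 5 / 3) * ((a + 1 : ℕ) : ℝ) ^ d := by
      rw [mul_assoc]
      exact mul_le_mul_of_nonneg_left hpd hpos.le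
    refine le_of_mul_le_mul_right ?_ hW
    rcases hcell with hc | hc
    · have h3 : (3 * d - 10 : ℝ) * ((a + 1 : ℕ) : ℝ) ^ d * (d + 1) ^ 3 ≤
          63 * scaledExpSum (a + 1) d := by
        have : ((3 * d - 10 : ℕ) : ℝ) = 3 * d - 10 := by
          rw [Nat.cast_sub (by omega)]; push_cast; ring
        rw [← this]
        exact_mod_cast hc
      have h4 : (d : ℝ) / t ≤ d / 2 := div_le_div_of_nonneg_left hdpos.le (by norm_num) ht.le
      calc (d / t - 5 / 3) * p d * (2 * (d + 1) ^ 3) * scaledExpSum (a + 1) d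
          = (d / t - 5 / 3) * p d * scaledExpSum (a + 1) d * (2 * (d + 1) ^ 3) := by ring
        _ ≤ (d / t - 5 / 3) * ((a + 1 : ℕ) : ℝ) ^ d * (2 * (d + 1) ^ 3) :=
            mul_le_mul_of_nonneg_right hX (by positivity)
        _ ≤ (d / 2 - 5 / 3) * ((a + 1 : ℕ) : ℝ) ^ d * (2 * (d + 1) ^ 3) := by gcongr
        _ ≤ 21 * scaledExpSum (a + 1) d := by linarith
    · have hG : (0 : ℝ) < scaledExpSum a (d - 1) := by exact_mod_cast scaledExpSum_pos a (d - 1)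
      have hW' : (0 : ℝ) < scaledExpSum a d := by exact_mod_cast scaledExpSum_pos a d
      have ha0 : (0 : ℝ) < a := by exact_mod_cast (by omega : 0 < a)
      have h3 : 2 * (3 * (scaledExpSum a d : ℝ) - 5 * a * (scaledExpSum a (d - 1) : ℝ)) *
          ((a + 1 : ℕ) : ℝ) ^ d * (d + 1) ^ 3 ≤
          63 * (a * (scaledExpSum a (d - 1) : ℝ)) * scaledExpSum (a + 1) d := by
        have h4 : 3 * (scaledExpSum a d : ℝ) - 5 * a * (scaledExpSum a (d - 1) : ℝ) ≤
            ((3 * scaledExpSum a d - 5 * a * scaledExpSum a (d - 1) : ℕ) : ℝ) := by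
          have : 3 * scaledExpSum a d ≤ (3 * scaledExpSum a d - 5 * a * scaledExpSum a (d - 1)) +
            5 * a * scaledExpSum a (d - 1) := by omega
          have h5 : (3 * scaledExpSum a d : ℝ) ≤
            ((3 * scaledExpSum a d - 5 * a * scaledExpSum a (d - 1) : ℕ) : ℝ) +
              5 * a * scaledExpSum a (d - 1) := by exact_mod_cast this
          linarith
        refine le_trans ?_ (by exact_mod_cast hc :
          2 * ((3 * scaledExpSum a d - 5 * a * scaledExpSum a (d - 1) : ℕ) : ℝ) *
            ((a + 1 : ℕ) : ℝ) ^ d * (d + 1) ^ 3 ≤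
            63 * (a * (scaledExpSum a (d - 1) : ℝ)) * scaledExpSum (a + 1) d)
        gcongr
      generalize (scaledExpSum a (d - 1) : ℝ) = G at *
      generalize (scaledExpSum a d : ℝ) = W' at *
      have haG : 0 < a * G := mul_pos ha0 hG
      have h4 : (d : ℝ) / t ≤ W' / (a * G) := by
        rw [div_le_div_iff₀ htpos haG]
        linarith
      have h5 : (d : ℝ) / t - 5 / 3 ≤ (3 * W' - 5 * a * G) / (3 * (a * G)) := by
        refine (sub_le_sub_right h4 _).trans (le_of_eq ?_)
        field_simp
      calc (d / t - 5 / 3) * p d * (2 * (d + 1) ^ 3) * scaledExpSum (a + 1) d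
          = (d / t - 5 / 3) * p d * scaledExpSum (a + 1) d * (2 * (d + 1) ^ 3) := by ring
        _ ≤ (d / t - 5 / 3) * ((a + 1 : ℕ) : ℝ) ^ d * (2 * (d + 1) ^ 3) :=
            mul_le_mul_of_nonneg_right hX (by positivity)
        _ ≤ (3 * W' - 5 * a * G) / (3 * (a * G)) * ((a + 1 : ℕ) : ℝ) ^ d *
              (2 * (d + 1) ^ 3) := by gcongr
        _ = (2 * (3 * W' - 5 * a * G) * ((a + 1 : ℕ) : ℝ) ^ d * (d + 1) ^ 3) / (3 * (a * G)) := by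
            ring
        _ ≤ (63 * (a * G) * scaledExpSum (a + 1) d) / (3 * (a * G)) := by gcongr
        _ = 21 * scaledExpSum (a + 1) d := by
            field_simp
            norm_num

/-- The excess of the point probability at `d ≥ 40`. With `t = 3 / 5 * (1 - w) * d`, the Chernoff
bound at `r = d / t` gives `5 / 3 * w * exp (-(2 / 5 * d - 1) * w) * (3 / 5 * exp (2 / 5)) ^ d`. -/
theorem excess_le_of_forty_le {pd t : ℝ} {d : ℕ} (hd : 40 ≤ d) (ht : 0 < t) (hpd : 0 ≤ pd)
    (hch : ∀ r : ℝ, 1 ≤ r → pd * r ^ d ≤ Real.exp (t * (r - 1))) :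
    (d / t - 5 / 3) * pd ≤ excessBound d := by
  have hd40 : (40 : ℝ) ≤ d := by exact_mod_cast hd
  have hdpos : (0 : ℝ) < d := by linarith
  rcases le_or_gt ((d : ℝ) / t - 5 / 3) 0 with hneg | hpos
  · exact (mul_nonpos_of_nonpos_of_nonneg hneg hpd).trans (excessBound_nonneg d)
  rw [excessBound, if_neg (by omega)]
  have ht3 : 5 * t < 3 * d := by
    have h : 5 / 3 < (d : ℝ) / t := by linarith
    rw [lt_div_iff₀ ht] at h
    linarith
  obtain ⟨v, hv⟩ : ∃ v : ℝ, v = 5 * t / (3 * d) := ⟨_, rfl⟩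
  have hv0 : 0 < v := by rw [hv]; positivity
  have hv1 : v < 1 := by rw [hv, div_lt_one (by positivity)]; exact ht3
  have htv : t = 3 / 5 * v * d := by rw [hv]; field_simp
  obtain ⟨w, hw⟩ : ∃ w : ℝ, w = 1 - v := ⟨_, rfl⟩
  have hr : (d : ℝ) / t = 5 / (3 * v) := by rw [htv]; field_simp
  have hc := hch (d / t) (by linarith)
  have hexp : t * ((d : ℝ) / t - 1) = d * (2 / 5) + d * (3 / 5 * w) := by
    rw [mul_sub, mul_div_cancel₀ _ ht.ne', htv, hw]; ring
  rw [hexp, hr, Real.exp_add] at hc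
  have hρ : Real.exp (2 / 5) ≤ 3 / 2 := by
    have h5 : Real.exp (2 / 5) ^ 5 ≤ (3 / 2) ^ 5 := by
      rw [← Real.exp_nat_mul, show ((5 : ℕ) : ℝ) * (2 / 5) = 1 + 1 by norm_num, Real.exp_add]
      nlinarith [Real.exp_one_lt_d9, Real.exp_pos 1]
    exact le_of_pow_le_pow_left₀ (by norm_num) (by norm_num) h5
  have hρd : Real.exp (d * (2 / 5)) ≤ (3 / 2) ^ d := by
    rw [Real.exp_nat_mul]
    exact pow_le_pow_left₀ (Real.exp_pos _).le hρ d
  -- `v ^ (d - 1) * exp (3 / 5 * d * w) ≤ exp (-15 * w)`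
  have hvd : v ^ (d - 1) * Real.exp (d * (3 / 5 * w)) ≤ Real.exp (-(15 * w)) := by
    have h1 : v ≤ Real.exp (-w) := by linarith [Real.add_one_le_exp (-w)]
    calc v ^ (d - 1) * Real.exp (d * (3 / 5 * w))
        ≤ Real.exp (-w) ^ (d - 1) * Real.exp (d * (3 / 5 * w)) := by gcongr
      _ = Real.exp (((d : ℝ) - 1) * -w + d * (3 / 5 * w)) := by
          rw [← Real.exp_nat_mul, ← Real.exp_add, Nat.cast_sub (by omega), Nat.cast_one]
      _ ≤ Real.exp (-(15 * w)) := by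
          refine Real.exp_le_exp.2 ?_
          nlinarith
  have hw15 : w * Real.exp (-(15 * w)) ≤ 1 / 40 := by
    have h1 : 15 * w ≤ Real.exp (15 * w - 1) := by linarith [Real.add_one_le_exp (15 * w - 1)]
    have h2 : 15 * w * Real.exp (-(15 * w)) ≤ Real.exp (-1) := by
      refine (mul_le_mul_of_nonneg_right h1 (Real.exp_pos _).le).trans (le_of_eq ?_)
      rw [← Real.exp_add]; ring_nf
    have h3 : Real.exp (-1) ≤ 3 / 8 := by
      rw [Real.exp_neg, inv_le_comm₀ (Real.exp_pos 1) (by norm_num)]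
      linarith [Real.exp_one_gt_d9]
    linarith
  have hpd' : pd ≤ Real.exp (d * (2 / 5)) * Real.exp (d * (3 / 5 * w)) * (3 / 5 * v) ^ d := by
    have h1 : (0 : ℝ) < (3 / 5 * v) ^ d := by positivity
    have h2 := mul_le_mul_of_nonneg_right hc h1.le
    rw [mul_assoc, ← mul_pow, show 5 / (3 * v) * (3 / 5 * v) = 1 by field_simp, one_pow,
      mul_one] at h2
    exact h2
  have hvpow : v ^ d = v ^ (d - 1) * v := by
    rw [← pow_succ]; congr 1; omega
  rw [hr]
  have hfac : 5 / (3 * v) - 5 / 3 = 5 / 3 * w / v := by rw [hw]; field_simp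
  rw [hr] at hpos
  calc (5 / (3 * v) - 5 / 3) * pd
      ≤ (5 / (3 * v) - 5 / 3) *
        (Real.exp (d * (2 / 5)) * Real.exp (d * (3 / 5 * w)) * (3 / 5 * v) ^ d) := by gcongr
    _ = 5 / 3 * (Real.exp (d * (2 / 5)) * (3 / 5) ^ d) *
        (w * (v ^ (d - 1) * Real.exp (d * (3 / 5 * w)))) := by
        rw [hfac, mul_pow, hvpow]; field_simp
    _ ≤ 5 / 3 * ((3 / 2) ^ d * (3 / 5) ^ d) * (1 / 40) := by
        have hw0 : 0 ≤ w := by linarith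
        have := (mul_le_mul_of_nonneg_left hvd hw0).trans hw15
        gcongr
    _ = (9 / 10) ^ d / 24 := by
        rw [← mul_pow, show (3 / 2 : ℝ) * (3 / 5) = 9 / 10 by norm_num]; ring

end Numerics

/-! ### Large cutoffs, and the bound in the product model -/

section LargeCutoffs

variable {ι : Type*} [Fintype ι] [DecidableEq ι] {n : ℕ} {q : ι → Fin n → ℝ}
  {α : ℝ} {m B : ℕ} {H : Finset ι}

/-- The excess bounds at time `t = α * k`, applied to the number of nulls with level below `k`. -/
theorem excess_mul_countLaw_le (h0 : ∀ i s, 0 ≤ q i s) (h1 : ∀ i, ∑ s, q i s = 1) (hα : 0 < α)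
    {d k : ℕ} (hd : 4 ≤ d) (hk : 2 < α * k) (hF : ∑ i ∈ H, levelCDF q i k ≤ α * k) :
    max ((d : ℝ) / k - 5 / 3 * α) 0 * countLaw q H k d ≤ α * excessBound d := by
  have hkpos : (0 : ℝ) < k := by
    by_contra h
    push Not at h
    nlinarith
  have hnn := countLaw_nonneg (H := H) (k := k) h0 d
  have hmain : ((d : ℝ) / (α * k) - 5 / 3) * countLaw q H k d ≤ excessBound d := by
    rcases lt_or_ge d 40 with h40 | h40
    · exact excess_le_of_lt_forty (countLaw_ultraLogConcave h0 h1 H k) (countLaw_nonneg h0) hd h40 hk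
        fun c hc => (sum_sub_mul_countLaw_le h0 h1 hc).trans (by linarith)
    · exact excess_le_of_forty_le h40 (by linarith) hnn
        fun r hr => countLaw_mul_pow_le h0 h1 hr hF d
  rw [max_mul_of_nonneg _ _ hnn, zero_mul]
  refine max_le ?_ (mul_nonneg hα.le (excessBound_nonneg d))
  have e : (d : ℝ) / k - 5 / 3 * α = α * (d / (α * k) - 5 / 3) := by field_simp
  rw [e, mul_assoc]
  exact mul_le_mul_of_nonneg_left hmain hα.le

/-- The false discovery rate of the step-up procedure in the product model, where the proportion of
false discoveries is the number of nulls below the cutoff divided by the cutoff. -/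
theorem prodExp_fdp_le [NeZero n] (h0 : ∀ i s, 0 ≤ q i s) (h1 : ∀ i, ∑ s, q i s = 1) (hα : 0 < α)
    (hα1 : α ≤ 1) (hm1 : 1 ≤ m) (hm : Fintype.card ι = m)
    (hF : ∀ k ≤ m, ∑ i ∈ H, levelCDF q i k ≤ α * k) :
    prodExp q (fun x => (countBelow H x (stepUp Finset.univ 0 m x) : ℝ) /
      stepUp Finset.univ 0 m x) ≤ 1.93 * α := by
  obtain ⟨B, hBdef⟩ : ∃ B : ℕ, B = min m ⌊2 / α⌋₊ := ⟨_, rfl⟩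
  have h2α : 0 ≤ 2 / α := by positivity
  have hB1 : 1 ≤ B := by
    rw [hBdef]
    refine le_min hm1 (Nat.le_floor ?_)
    rw [Nat.cast_one, le_div_iff₀ hα]
    linarith
  have hBm : B ≤ m := hBdef ▸ min_le_left _ _
  have hαB : α * B ≤ 2 := by
    have : (B : ℝ) ≤ 2 / α :=
      le_trans (by exact_mod_cast hBdef ▸ min_le_right _ _) (Nat.floor_le h2α)
    rw [le_div_iff₀ hα] at this
    linarith
  have hlarge : ∀ k : ℕ, B < k → k ≤ m → 2 < α * k := by
    intro k hk hkm
    have h : ⌊2 / α⌋₊ < k := by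
      rcases min_lt_iff.1 (hBdef ▸ hk) with h | h <;> omega
    have := (Nat.floor_lt h2α).1 h
    rw [div_lt_iff₀ hα] at this
    linarith
  set κ : ℕ → (ι → Fin n) → ℕ := fun d x => stepUp Hᶜ d m x with hκ
  have hsmall := prodExp_fdp_small h0 h1 hα.le hm hF hB1 hBm hαB
  have hcompl : prodExp q (fun x => if stepUp Finset.univ 0 m x ≤ B then (1 : ℝ) else 0) +
      prodExp q (fun x => if stepUp Finset.univ 0 m x ≤ B then (0 : ℝ) else 1) = 1 := by
    rw [← prodExp_add]
    refine Eq.trans ?_ (prodExp_const (q := q) h1 1)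
    congr 1
    funext x
    split_ifs <;> norm_num
  -- the excess over `5 / 3 * α` on large cutoffs, split by cutoff and number of false discoveries
  have hexcess : prodExp q (fun x => ∑ d ∈ Finset.Icc 4 m, ∑ k ∈ Finset.Ioc B m,
      max ((d : ℝ) / k - 5 / 3 * α) 0 *
        ((if countBelow H x k = d then 1 else 0) * (if κ d x = k then 1 else 0))) ≤
      α * (79 / 300) := by
    rw [prodExp_sum]
    refine le_trans (Finset.sum_le_sum (g := fun d => α * excessBound d) fun d hd => ?_) ?_
    · rw [prodExp_sum]
      have hterm : ∀ k ∈ Finset.Ioc B m, prodExp q (fun x =>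
          max ((d : ℝ) / k - 5 / 3 * α) 0 *
          ((if countBelow H x k = d then 1 else 0) * (if κ d x = k then 1 else 0))) ≤
          α * excessBound d * prodExp q (fun x => if κ d x = k then 1 else 0) := by
        intro k hk
        obtain ⟨hk1, hk2⟩ := Finset.mem_Ioc.1 hk
        rw [prodExp_const_mul, prodExp_mul_of_blocks H
          (g := fun x => if countBelow H x k = d then (1 : ℝ) else 0)
          (h := fun x => if κ d x = k then (1 : ℝ) else 0) ?_ ?_ h1, ← mul_assoc]
        · refine mul_le_mul_of_nonneg_right ?_
            (prodExp_nonneg h0 fun x => by split_ifs <;> norm_num)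
          exact excess_mul_countLaw_le h0 h1 hα (Finset.mem_Icc.1 hd).1 (hlarge k hk1 hk2)
            (hF k hk2)
        · intro x y hxy
          have : countBelow H x k = countBelow H y k :=
            congrArg Finset.card (Finset.filter_congr fun i hi => by rw [hxy i hi])
          simp only [this]
        · intro x y hxy
          have : κ d x = κ d y := stepUp_congr fun i hi => hxy i (Finset.mem_compl.1 hi)
          simp only [this]
      refine (Finset.sum_le_sum hterm).trans ?_
      rw [← Finset.mul_sum, ← prodExp_sum]
      refine mul_le_of_le_one_right (mul_nonneg hα.le (excessBound_nonneg d)) ?_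
      refine (prodExp_mono h0 fun x => ?_).trans (prodExp_const (q := q) h1 1).le
      rw [Finset.sum_ite_eq]
      split_ifs <;> norm_num
    · rw [← Finset.mul_sum]
      exact mul_le_mul_of_nonneg_left (sum_excessBound_le m) hα.le
  have hpoint : prodExp q (fun x => (countBelow H x (stepUp Finset.univ 0 m x) : ℝ) /
      stepUp Finset.univ 0 m x) ≤
      prodExp q (fun x => if stepUp Finset.univ 0 m x ≤ B then
        (countBelow H x (stepUp Finset.univ 0 m x) : ℝ) / stepUp Finset.univ 0 m x else 0) +
      5 / 3 * α * prodExp q (fun x => if stepUp Finset.univ 0 m x ≤ B then (0 : ℝ) else 1) +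
      prodExp q (fun x => ∑ d ∈ Finset.Icc 4 m, ∑ k ∈ Finset.Ioc B m,
      max ((d : ℝ) / k - 5 / 3 * α) 0 *
        ((if countBelow H x k = d then 1 else 0) * (if κ d x = k then 1 else 0))) := by
    rw [← prodExp_const_mul, ← prodExp_add, ← prodExp_add]
    refine prodExp_mono h0 fun x => ?_
    have hterm : ∀ d k : ℕ, 0 ≤ max ((d : ℝ) / k - 5 / 3 * α) 0 *
        ((if countBelow H x k = d then (1 : ℝ) else 0) * (if κ d x = k then 1 else 0)) :=
      fun d k => mul_nonneg (le_max_right _ _)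
        (mul_nonneg (by split_ifs <;> norm_num) (by split_ifs <;> norm_num))
    have hinner : ∀ d : ℕ, 0 ≤ ∑ k ∈ Finset.Ioc B m, max ((d : ℝ) / k - 5 / 3 * α) 0 *
        ((if countBelow H x k = d then (1 : ℝ) else 0) * (if κ d x = k then 1 else 0)) :=
      fun d => Finset.sum_nonneg fun k _ => hterm d k
    have hsum := Finset.sum_nonneg fun d (_ : d ∈ Finset.Icc 4 m) => hinner d
    have hKm : stepUp Finset.univ 0 m x ≤ m := stepUp_le
    have hκK := stepUp_compl_eq hm H x
    have hVK : countBelow H x (stepUp Finset.univ 0 m x) ≤ stepUp Finset.univ 0 m x := by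
      have h2 := countBelow_add_compl H x (stepUp Finset.univ 0 m x)
      rw [countBelow_stepUp hm x] at h2
      omega
    set K := stepUp Finset.univ 0 m x with hK
    set V := countBelow H x K with hV
    by_cases hKB : K ≤ B
    · simp only [if_pos hKB, mul_zero, add_zero]
      linarith
    · simp only [if_neg hKB, mul_one, zero_add]
      push Not at hKB
      have h2 := hlarge K hKB hKm
      have hKpos : (0 : ℝ) < K := by exact_mod_cast (by omega : 0 < K)
      rcases lt_or_ge V 4 with hV4 | hV4
      · have h3 : (V : ℝ) ≤ 3 := by exact_mod_cast Nat.lt_succ_iff.1 hV4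
        have : (V : ℝ) / K ≤ 5 / 3 * α := by
          rw [div_le_iff₀ hKpos]
          linarith
        linarith
      · have hs1 := Finset.single_le_sum (fun d _ => hinner d)
          (Finset.mem_Icc.2 ⟨hV4, hVK.trans hKm⟩)
        have hs2 := Finset.single_le_sum (fun k _ => hterm V k) (Finset.mem_Ioc.2 ⟨hKB, hKm⟩)
        have hκV : κ V x = K := hκK (by omega)
        rw [if_pos rfl, if_pos hκV, mul_one, mul_one] at hs2
        have := le_max_left ((V : ℝ) / K - 5 / 3 * α) 0
        linarith
  have hexp : (1.93 : ℝ) * α = 5 / 3 * α * 1 + α * (79 / 300) := by ring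
  rw [hexp, ← hcompl]
  linarith

end LargeCutoffs

/-! ### Transfer to the product model -/

section Transfer

/-- The number of thresholds `α * k / m`, `1 ≤ k ≤ m`, that lie strictly below `u`. -/
noncomputable def pLevel (α : ℝ) (m : ℕ) (u : ℝ) : Fin (m + 1) :=
  ⟨((Finset.Icc 1 m).filter fun k : ℕ => α * (k : ℝ) / (m : ℝ) < u).card,
    Nat.lt_succ_iff.2 ((Finset.card_filter_le _ _).trans (by simp))⟩

variable {α : ℝ} {m : ℕ}

theorem pLevel_lt_iff (hα : 0 ≤ α) {k : ℕ} (hk : 1 ≤ k) (hkm : k ≤ m) (u : ℝ) :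
    (pLevel α m u : ℕ) < k ↔ u ≤ α * k / m := by
  have hmono : ∀ {a b : ℕ}, a ≤ b → α * (a : ℝ) / m ≤ α * b / m := fun h => by gcongr
  constructor
  · intro h
    by_contra hu
    push Not at hu
    have hsub : Finset.Icc 1 k ⊆
        (Finset.Icc 1 m).filter fun k : ℕ => α * (k : ℝ) / (m : ℝ) < u := fun l hl => by
      rw [Finset.mem_Icc] at hl
      exact Finset.mem_filter.2 ⟨Finset.mem_Icc.2 ⟨hl.1, hl.2.trans hkm⟩, (hmono hl.2).trans_lt hu⟩
    have hc := Finset.card_le_card hsub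
    rw [Nat.card_Icc, Nat.add_sub_cancel] at hc
    exact absurd h (not_lt.2 hc)
  · intro hu
    have hsub : ((Finset.Icc 1 m).filter fun k : ℕ => α * (k : ℝ) / (m : ℝ) < u) ⊆
        Finset.Icc 1 (k - 1) := fun l hl => by
      rw [Finset.mem_filter, Finset.mem_Icc] at hl
      refine Finset.mem_Icc.2 ⟨hl.1.1, ?_⟩
      by_contra hlk
      exact absurd (hl.2.trans_le hu) (not_lt.2 (hmono (by omega)))
    have hc := Finset.card_le_card hsub
    rw [Nat.card_Icc] at hc
    exact lt_of_le_of_lt hc (by omega)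

theorem measurable_pLevel (α : ℝ) (m : ℕ) : Measurable (pLevel α m) := by
  refine measurable_to_countable' fun s => ?_
  have hmeas : Measurable fun u : ℝ =>
      ((Finset.Icc 1 m).filter fun k : ℕ => α * (k : ℝ) / (m : ℝ) < u).card := by
    simp only [Finset.card_filter]
    exact Finset.measurable_sum _ fun k _ =>
      Measurable.ite measurableSet_Ioi measurable_const measurable_const
  have : pLevel α m ⁻¹' {s} = (fun u : ℝ =>
      ((Finset.Icc 1 m).filter fun k : ℕ => α * (k : ℝ) / (m : ℝ) < u).card) ⁻¹' {(s : ℕ)} := by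
    ext u
    simp [pLevel, Fin.ext_iff]
  rw [this]
  exact hmeas (measurableSet_singleton _)

/-- The false discovery proportion of the Benjamini-Hochberg procedure in terms of levels. With
cutoff `0` both sides vanish, as no value is then at most `0`. -/
theorem fdp_bhSet_eq (hα : 0 ≤ α) (hm : 1 ≤ m) (H₀ : Finset (Fin m)) (x : Fin m → ℝ) :
    fdp H₀ (bhSet α x) =
      (countBelow H₀ (fun i => pLevel α m (x i))
        (stepUp Finset.univ 0 m fun i => pLevel α m (x i)) : ℝ) /
      (stepUp Finset.univ 0 m fun i => pLevel α m (x i) : ℕ) := by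
  have hcut : bhCutoff α x = stepUp Finset.univ 0 m fun i => pLevel α m (x i) := by
    rw [bhCutoff, stepUp]
    refine congrArg (fun s : Finset ℕ => s.sup id) (Finset.filter_congr fun k hk => ?_)
    rw [Finset.mem_Icc] at hk
    simp only [countBelow, pLevel_lt_iff hα hk.1 hk.2, add_zero]
  have hN := countBelow_stepUp (Fintype.card_fin m) fun i => pLevel α m (x i)
  have hKm : stepUp Finset.univ 0 m (fun i => pLevel α m (x i)) ≤ m := stepUp_le
  rcases Nat.eq_zero_or_pos (stepUp Finset.univ 0 m fun i => pLevel α m (x i)) with h0 | hpos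
  · have hempty : bhSet α x = ∅ := by
      refine Finset.filter_eq_empty_iff.2 fun i _ hi => ?_
      rw [hcut, h0, Nat.cast_zero, mul_zero, zero_div] at hi
      have hi' : (pLevel α m (x i) : ℕ) < 1 :=
        (pLevel_lt_iff hα le_rfl hm _).2 (hi.trans (by positivity))
      have hc : 1 ≤ countBelow Finset.univ (fun i => pLevel α m (x i)) 1 :=
        Finset.card_pos.2 ⟨i, Finset.mem_filter.2 ⟨Finset.mem_univ _, hi'⟩⟩
      have := le_stepUp (s := Finset.univ) (c := 0) (B := m)
        (x := fun i => pLevel α m (x i)) le_rfl hm hc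
      omega
    simp [fdp, hempty, h0]
  · have hset : bhSet α x = Finset.univ.filter fun i =>
        (pLevel α m (x i) : ℕ) < stepUp Finset.univ 0 m fun i => pLevel α m (x i) := by
      rw [bhSet, hcut]
      exact Finset.filter_congr fun i _ => (pLevel_lt_iff hα hpos hKm _).symm
    have hcard : (bhSet α x).card = stepUp Finset.univ 0 m fun i => pLevel α m (x i) := by
      rw [hset]; exact hN
    have hinter : (bhSet α x ∩ H₀).card = countBelow H₀ (fun i => pLevel α m (x i))
        (stepUp Finset.univ 0 m fun i => pLevel α m (x i)) := by
      rw [hset, Finset.filter_inter, Finset.univ_inter]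
      rfl
    rw [fdp, hcard, hinter, max_eq_right (by exact_mod_cast hpos)]

variable {Ω : Type*} [MeasurableSpace Ω] {P : Measure Ω} [IsProbabilityMeasure P]

/-- The expectation of a function of finitely many independent finitely-valued variables is an
expectation in the product model. -/
theorem integral_comp_eq_prodExp {ι S : Type*} [Fintype ι] [DecidableEq ι] [Fintype S]
    [MeasurableSpace S] [MeasurableSingletonClass S] {L : ι → Ω → S} (hL : ∀ i, Measurable (L i))
    (hind : iIndepFun L P) (G : (ι → S) → ℝ) :
    Integrable (fun ω => G fun i => L i ω) P ∧
      ∫ ω, G (fun i => L i ω) ∂P = prodExp (fun i s => P.real (L i ⁻¹' {s})) G := by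
  have hmeas : Measurable fun ω i => L i ω := measurable_pi_lambda _ hL
  have hprob : IsProbabilityMeasure (P.map fun ω i => L i ω) :=
    Measure.isProbabilityMeasure_map hmeas.aemeasurable
  have hint : Integrable G (P.map fun ω i => L i ω) := Integrable.of_finite
  refine ⟨hint.comp_measurable hmeas, ?_⟩
  have hG : Measurable G := measurable_of_finite G
  rw [← integral_map hmeas.aemeasurable hG.aestronglyMeasurable, integral_fintype hint, prodExp]
  refine Finset.sum_congr rfl fun x _ => ?_
  rw [smul_eq_mul]
  congr 1
  rw [map_measureReal_apply hmeas (measurableSet_singleton x)]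
  have hset : (fun ω i => L i ω) ⁻¹' {x} = ⋂ i ∈ Finset.univ, L i ⁻¹' {x i} := by
    ext ω
    simp [funext_iff]
  rw [hset, measureReal_def, hind.measure_inter_preimage_eq_mul Finset.univ
    (fun i _ => measurableSet_singleton (x i)), ENNReal.toReal_prod]
  rfl

end Transfer

theorem theorem1 {Ω : Type*} [MeasurableSpace Ω] (P : Measure Ω) [IsProbabilityMeasure P]
    (α : ℝ) (hα : α ∈ Set.Icc (0 : ℝ) 1) (m : ℕ) (hm : 1 ≤ m) (H₀ : Finset (Fin m))
    (p : Fin m → Ω → ℝ) (hp_meas : ∀ i, Measurable (p i))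
    (hp_mem : ∀ i ω, p i ω ∈ Set.Icc (0 : ℝ) 1)
    (hp_indep : iIndepFun p P) (hp_compound : IsCompoundPValues P H₀ p) :
    Integrable (fun ω => fdp H₀ (bhSet α fun i => p i ω)) P ∧
      bhFDR P α H₀ p ≤ 1.93 * α := by
  obtain ⟨hα0, hα1⟩ := hα
  set L : Fin m → Ω → Fin (m + 1) := fun i ω => pLevel α m (p i ω) with hL
  have hLmeas : ∀ i, Measurable (L i) := fun i => (measurable_pLevel α m).comp (hp_meas i)
  have hLind : iIndepFun L P := hp_indep.comp (fun _ => pLevel α m) fun _ => measurable_pLevel α m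
  obtain ⟨hint, heq⟩ := integral_comp_eq_prodExp hLmeas hLind fun x : Fin m → Fin (m + 1) =>
    (countBelow H₀ x (stepUp Finset.univ 0 m x) : ℝ) / stepUp Finset.univ 0 m x
  simp only [bhFDR, fdp_bhSet_eq hα0 hm]
  refine ⟨hint, heq.le.trans ?_⟩
  set q : Fin m → Fin (m + 1) → ℝ := fun i s => P.real (L i ⁻¹' {s}) with hq
  have h0 : ∀ i s, 0 ≤ q i s := fun i s => measureReal_nonneg
  have h1 : ∀ i, ∑ s, q i s = 1 := fun i => by
    rw [hq, sum_measureReal_preimage_singleton _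
      fun s _ => hLmeas i (measurableSet_singleton s)]
    simp
  have hcdf : ∀ i, ∀ k, 1 ≤ k → k ≤ m →
      levelCDF q i k = P.real {ω | p i ω ≤ α * k / m} := by
    intro i k hk hkm
    rw [levelCDF, ← Finset.sum_filter, hq, sum_measureReal_preimage_singleton _
      fun s _ => hLmeas i (measurableSet_singleton s)]
    congr 1
    ext ω
    simp [hL, pLevel_lt_iff hα0 hk hkm]
  have hmpos : (0 : ℝ) < m := by exact_mod_cast hm
  have hF : ∀ k ≤ m, ∑ i ∈ H₀, levelCDF q i k ≤ α * k := by
    intro k hkm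
    rcases Nat.eq_zero_or_pos k with rfl | hk
    · simp [levelCDF]
    · rw [Finset.sum_congr rfl fun i _ => hcdf i k hk hkm]
      have hkm' : (k : ℝ) ≤ m := by exact_mod_cast hkm
      refine (hp_compound (α * k / m) ⟨by positivity, ?_⟩).trans (le_of_eq ?_)
      · rw [div_le_one hmpos]
        nlinarith [Nat.cast_nonneg (α := ℝ) k]
      · field_simp
  rcases hα0.eq_or_lt with rfl | hαpos
  · -- at level zero every null lies above all thresholds almost surely
    have hV : ∀ x : Fin m → Fin (m + 1), (countBelow H₀ x (stepUp Finset.univ 0 m x) : ℝ) /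
        stepUp Finset.univ 0 m x ≤ countBelow H₀ x m := fun x => by
      have hle : (countBelow H₀ x (stepUp Finset.univ 0 m x) : ℝ) ≤ countBelow H₀ x m := by
        exact_mod_cast countBelow_mono stepUp_le
      rcases Nat.eq_zero_or_pos (stepUp Finset.univ 0 m x) with hK | hK
      · simp [hK]
      · exact (div_le_self (Nat.cast_nonneg _) (by exact_mod_cast hK)).trans hle
    rw [mul_zero]
    refine (prodExp_mono h0 hV).trans ?_
    rw [prodExp_countBelow h1]
    simpa using hF m le_rfl
  · exact prodExp_fdp_le h0 h1 hαpos hα1 hm (Fintype.card_fin m) hF
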